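/- **Setting.** On $\mathbb C^2$ let $\langle(z_1,w_1),(z_2,w_2)\rangle=\operatorname{Re}(z_1\bar z_2-w_1\bar w_2)$. Let $\bar G=\{(z,w):|z|^2-|w|^2=-1\}$, identified with $\mathrm{SU}(1,1)$ by $\begin{pmatrix}\bar w&z\\ \bar z&w\end{pmatrix}\mapsto(z,w)$, let $\bar L=\{(z,w):|z|<|w|\}$ be the cone over $\bar G$, and let $\pi:L\to\bar L$ be the universal covering, so that $G=\pi^{-1}(\bar G)\subset L$ is the universal cover of $\mathrm{SU}(1,1)$, with unit $e$. The group $G$ acts on the unit disc $\mathbb D$ (the hyperbolic plane of curvature $-1$) through $\mathrm{PSU}(1,1)$, by $(z,w)\cdot x=(\bar wx+z)/(\bar zx+w)$. For $g\in G$ let $E_g$ and $I_g$ be the connected components containing $g$ of $\pi^{-1}\{a\in\bar L:\langle\pi(g),a\rangle=-1\}$ and of $\pi^{-1}\{a\in\bar L:\langle\pi(g),a\rangle\le-1\}$, and let $H_g$ be the closure of $L\setminus I_g$. A subgroup of $G$ has level $k\ge1$ if its intersection with the centre of $G$ has index $k$ in the centre. Let $p_1\ge2$, $p_2\ge1$ and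 $q\ge r\ge2$ be integers, and let $u=0,v,w\in\mathbb D$ be the vertices of a hyperbolic triangle with angles $\pi/p_1,\pi/q,\pi/r$. Let $\Gamma_1\subset G$ be a subgroup of level $k$ whose image $\bar\Gamma_1$ in $\mathrm{PSU}(1,1)$ is the triangle group generated by the rotations through $2\pi/p_1,2\pi/q,2\pi/r$ about $u,v,w$. Let $\Gamma_2\subset G$ be a subgroup of level $k$ whose image in $\mathrm{PSU}(1,1)$ is the cyclic group of order $p_2$ generated by the rotation through $2\pi/p_2$ about $u$. Let $p=\operatorname{lcm}(p_1,p_2)$ and suppose that $p\ge kq/2$. For $x$ in the orbit $\Gamma_1(u)$ put $$Q_x=\bigcap_{(g_1,g_2)\in\Gamma_1\times\Gamma_2,\ g_1(u)=x}H_{g_1g_2}.$$ Let the edge corona $\mathcal E$ consist of the points of $\Gamma_1(u)\setminus\{u\}$ whose Dirichlet region (with respect to $\Gamma_1(u)$) shares at least an edge with the Dirichlet region of $u$. Put $$F_e^\circ=(E_e\cap\partial Q_u)^\circ\setminus\bigcup_{x\in\Gamma_1(u)\setminus\{u\}}Q_x,\qquad F_{\mathcal E}=(E_e\cap\partial Q_u)^\circ\setminus\bigcup_{x\in\mathcal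 E}Q_x,$$ where $(E_e\cap\partial Q_u)^\circ$ is the interior relative to $E_e$; here $F_e^\circ$ is the interior of the fundamental domain $F_e$. Let $L_0$ be the hyperbolic distance between $u$ and $v$, and put $$\ell^-(t)=\frac1{\tanh L_0}-\frac1{\sinh L_0\,\sin\frac\pi q}\sqrt{\frac1{t^2}-\cos^2\frac\pi q}.$$ **Theorem.** Let $R\ge\tanh L_0$ be such that $$\{x\in\Gamma_1(u):|x|<R\}=\mathcal E\cup\{u\}\qquad\text{and}\qquad \ell^-\Big(\sec\frac{\pi k}{2p}\Big)\le\frac{1-\sqrt{1-R^2}}R.$$ Then $F_e^\circ=F_{\mathcal E}$. -/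

import Mathlib

open scoped ComplexConjugate
open Complex.UnitDisc

noncomputable section

namespace LorentzBiquotient

/-! ### The universal covers of the quadric and of the cone over it -/

/-- The universal cover `L` of the cone `{(z, w) ∈ ℂ² | |z| < |w|}`. Since `w ≠ 0` on the cone, a
point of the cover is a pair `(z, ω)` with `|z| < |exp ω|`, lying over `(z, exp ω)`; the space of
such pairs is homeomorphic to (open disc) × `ℂ`. -/
@[ext]
structure Cover where
  z : ℂ
  ω : ℂ
  norm_lt : ‖z‖ < ‖Complex.exp ω‖

namespace Cover

instance : TopologicalSpace Cover :=
  TopologicalSpace.induced (fun a : Cover => (a.z, a.ω)) inferInstance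

/-- The second coordinate of the point of the cone under `a`. -/
def w (a : Cover) : ℂ := Complex.exp a.ω

/-- The covering map onto the cone. -/
def proj (a : Cover) : ℂ × ℂ := (a.z, a.w)

/-- `|w|² - |z|²`, the negative of the quadratic form; it is the determinant of the matrix
`(conj w, z; conj z, w)`. -/
def nrm (a : Cover) : ℝ := ‖a.w‖ ^ 2 - ‖a.z‖ ^ 2

theorem w_ne_zero (a : Cover) : a.w ≠ 0 := Complex.exp_ne_zero _

theorem norm_lt' (a : Cover) : ‖a.z‖ < ‖a.w‖ := a.norm_lt

theorem norm_w_pos (a : Cover) : 0 < ‖a.w‖ := norm_pos_iff.2 a.w_ne_zero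

theorem nrm_pos (a : Cover) : 0 < a.nrm := by
  have h := a.norm_lt'
  have h0 := norm_nonneg a.z
  unfold nrm
  nlinarith

/-- The quotient `conj z₁ z₂ / (w₁ w₂)`. -/
def quot (a b : Cover) : ℂ := conj a.z * b.z / (a.w * b.w)

theorem norm_quot_lt (a b : Cover) : ‖quot a b‖ < 1 := by
  have ha := a.norm_lt'
  have hb := b.norm_lt'
  have ha0 := norm_nonneg a.z
  have hb0 := norm_nonneg b.z
  have hwa := a.norm_w_pos
  have hwb := b.norm_w_pos
  unfold quot
  rw [norm_div, norm_mul, norm_mul, Complex.norm_conj, div_lt_one (by positivity)]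
  nlinarith

theorem re_one_add_quot_pos (a b : Cover) : 0 < (1 + quot a b).re := by
  have h := (abs_le.1 (Complex.abs_re_le_norm (quot a b))).1
  have h' := norm_quot_lt a b
  simp only [Complex.add_re, Complex.one_re]
  linarith

theorem one_add_quot_ne_zero (a b : Cover) : 1 + quot a b ≠ 0 := by
  intro h
  have := re_one_add_quot_pos a b
  rw [h] at this
  simp at this

theorem exp_mul (a b : Cover) :
    Complex.exp (a.ω + b.ω + Complex.log (1 + quot a b)) = conj a.z * b.z + a.w * b.w := by
  have hwa := a.w_ne_zero
  have hwb := b.w_ne_zero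
  rw [Complex.exp_add, Complex.exp_add, Complex.exp_log (one_add_quot_ne_zero a b)]
  change a.w * b.w * _ = _
  unfold quot
  field_simp
  ring

theorem norm_identity (z₁ w₁ z₂ w₂ : ℂ) :
    ‖conj z₁ * z₂ + w₁ * w₂‖ ^ 2 - ‖conj w₁ * z₂ + z₁ * w₂‖ ^ 2
      = (‖w₁‖ ^ 2 - ‖z₁‖ ^ 2) * (‖w₂‖ ^ 2 - ‖z₂‖ ^ 2) := by
  simp only [← Complex.normSq_eq_norm_sq, Complex.normSq_apply, Complex.add_re, Complex.add_im,
    Complex.mul_re, Complex.mul_im, Complex.conj_re, Complex.conj_im]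
  ring

/-- The product of `L`: it covers the product of the matrices `(conj w, z; conj z, w)`. The
argument of the principal logarithm lies in the open right half-plane, so that the product is
continuous. -/
instance : Mul Cover where
  mul a b :=
    { z := conj a.w * b.z + a.z * b.w
      ω := a.ω + b.ω + Complex.log (1 + quot a b)
      norm_lt := by
        rw [exp_mul]
        have h := norm_identity a.z a.w b.z b.w
        have ha := a.nrm_pos
        have hb := b.nrm_pos
        have hab := mul_pos ha hb
        unfold nrm at hab
        rw [← h] at hab
        exact lt_of_pow_lt_pow_left₀ 2 (norm_nonneg _) (by linarith) }

theorem mul_z (a b : Cover) : (a * b).z = conj a.w * b.z + a.z * b.w := rfl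

theorem mul_ω (a b : Cover) : (a * b).ω = a.ω + b.ω + Complex.log (1 + quot a b) := rfl

theorem mul_w (a b : Cover) : (a * b).w = conj a.z * b.z + a.w * b.w := exp_mul a b

theorem mul_nrm (a b : Cover) : (a * b).nrm = a.nrm * b.nrm := by
  unfold nrm
  rw [mul_z, mul_w, norm_identity]

instance : One Cover where
  one := { z := 0, ω := 0, norm_lt := by simp }

theorem one_z : (1 : Cover).z = 0 := rfl

theorem one_ω : (1 : Cover).ω = 0 := rfl

theorem one_w : (1 : Cover).w = 1 := by simp [w, one_ω]

/-- The inverse of `L`: it covers the inverse of the matrix `(conj w, z; conj z, w)`. -/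
instance : Inv Cover where
  inv a :=
    { z := -a.z / a.nrm
      ω := conj a.ω - Real.log a.nrm
      norm_lt := by
        have h := a.nrm_pos
        rw [Complex.exp_sub, Complex.exp_conj, ← Complex.ofReal_exp, Real.exp_log h, norm_div,
          norm_div, norm_neg, Complex.norm_conj, Complex.norm_real, Real.norm_of_nonneg h.le]
        exact div_lt_div_of_pos_right a.norm_lt h }

theorem inv_z (a : Cover) : (a⁻¹).z = -a.z / a.nrm := rfl

theorem inv_ω (a : Cover) : (a⁻¹).ω = conj a.ω - Real.log a.nrm := rfl

theorem inv_w (a : Cover) : (a⁻¹).w = conj a.w / a.nrm := by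
  unfold w
  rw [inv_ω, Complex.exp_sub, Complex.exp_conj, ← Complex.ofReal_exp, Real.exp_log a.nrm_pos]

theorem abs_im_log_lt (a b : Cover) : |(Complex.log (1 + quot a b)).im| < Real.pi / 2 := by
  rw [Complex.log_im]
  exact Complex.abs_arg_lt_pi_div_two_iff.2 (Or.inl (re_one_add_quot_pos a b))

protected theorem mul_assoc (a b c : Cover) : a * b * c = a * (b * c) := by
  have hw : (a * b * c).w = (a * (b * c)).w := by
    simp only [mul_w, mul_z, map_add, map_mul, Complex.conj_conj]
    ring
  apply Cover.ext
  · simp only [mul_w, mul_z, map_add, map_mul, Complex.conj_conj]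
    ring
  · obtain ⟨n, hn⟩ := Complex.exp_eq_exp_iff_exists_int.1 hw
    have h1 := abs_lt.1 (abs_im_log_lt (a * b) c)
    have h2 := abs_lt.1 (abs_im_log_lt a b)
    have h3 := abs_lt.1 (abs_im_log_lt a (b * c))
    have h4 := abs_lt.1 (abs_im_log_lt b c)
    have him := congrArg Complex.im hn
    simp only [mul_ω, Complex.add_im, Complex.mul_im, Complex.mul_re, Complex.intCast_re,
      Complex.intCast_im, Complex.ofReal_re, Complex.ofReal_im, Complex.I_re, Complex.I_im,
      Complex.re_ofNat, Complex.im_ofNat, mul_zero, mul_one, zero_mul, sub_zero,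
      add_zero] at him
    have hpi := Real.pi_pos
    have hlt : (n : ℝ) < 1 := by
      by_contra! h
      nlinarith [h1.1, h1.2, h2.1, h2.2, h3.1, h3.2, h4.1, h4.2]
    have hgt : (-1 : ℝ) < n := by
      by_contra! h
      nlinarith [h1.1, h1.2, h2.1, h2.2, h3.1, h3.2, h4.1, h4.2]
    have hn0 : n = 0 := by
      have h5 : n < 1 := by exact_mod_cast hlt
      have h6 : -1 < n := by exact_mod_cast hgt
      omega
    simpa [hn0] using hn

protected theorem one_mul (a : Cover) : 1 * a = a := by
  apply Cover.ext
  · rw [mul_z, one_w, one_z]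
    simp
  · rw [mul_ω, one_ω]
    simp [quot, one_z]

protected theorem mul_one (a : Cover) : a * 1 = a := by
  apply Cover.ext
  · rw [mul_z, one_w, one_z]
    simp
  · rw [mul_ω, one_ω]
    simp [quot, one_z]

protected theorem inv_mul_cancel (a : Cover) : a⁻¹ * a = 1 := by
  have hn := a.nrm_pos
  have hnC : (a.nrm : ℂ) ≠ 0 := by exact_mod_cast hn.ne'
  have hwa := a.w_ne_zero
  have hwc : conj a.w ≠ 0 := by simpa using hwa
  have hwp := a.norm_w_pos
  apply Cover.ext
  · rw [mul_z, inv_w, inv_z, one_z, map_div₀, Complex.conj_conj, Complex.conj_ofReal]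
    ring
  · have hq : 1 + quot a⁻¹ a = ((a.nrm / ‖a.w‖ ^ 2 : ℝ) : ℂ) := by
      unfold quot
      rw [inv_w, inv_z, map_div₀, Complex.conj_ofReal, map_neg]
      push_cast
      have e1 : ((‖a.w‖ : ℂ)) ^ 2 = conj a.w * a.w := (Complex.conj_mul' a.w).symm
      have e2 : (a.nrm : ℂ) = conj a.w * a.w - conj a.z * a.z := by
        unfold nrm
        push_cast
        rw [Complex.conj_mul', Complex.conj_mul']
      rw [e1]
      field_simp
      rw [e2]
      ring
    have hlog : Real.log ‖a.w‖ = a.ω.re := by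
      rw [w, Complex.norm_exp, Real.log_exp]
    rw [mul_ω, one_ω, hq, inv_ω, ← Complex.ofReal_log (by positivity),
      Real.log_div hn.ne' (by positivity), Real.log_pow, hlog]
    apply Complex.ext <;> simp
    ring

instance : Group Cover :=
  Group.ofLeftAxioms Cover.mul_assoc Cover.one_mul Cover.inv_mul_cancel

end Cover

/-- The group `G`, the universal cover of `SU(1,1) = {(z, w) | |z|² - |w|² = -1}`, as a
hypersurface of `L`. -/
def G : Subgroup Cover where
  carrier := {a | a.nrm = 1}
  mul_mem' := by
    intro a b ha hb
    change (a * b).nrm = 1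
    rw [Cover.mul_nrm, ha, hb, one_mul]
  one_mem' := by
    change (1 : Cover).nrm = 1
    simp [Cover.nrm, Cover.one_w, Cover.one_z]
  inv_mem' := by
    intro a ha
    change (a⁻¹).nrm = 1
    have h := Cover.mul_nrm a⁻¹ a
    have h1 : (1 : Cover).nrm = 1 := by simp [Cover.nrm, Cover.one_w, Cover.one_z]
    rw [Cover.inv_mul_cancel, h1] at h
    have ha' : a.nrm = 1 := ha
    rw [ha', mul_one] at h
    exact h.symm

/-! ### The action on the hyperbolic plane -/

theorem disc_ne_zero (a : Cover) (x : 𝔻) : conj a.z * x + a.w ≠ 0 := by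
  intro h
  have h1 : a.w = -(conj a.z * x) := by linear_combination h
  have h2 : ‖a.w‖ = ‖a.z‖ * ‖(x : ℂ)‖ := by rw [h1, norm_neg, norm_mul, Complex.norm_conj]
  nlinarith [a.norm_lt', x.norm_lt_one, norm_nonneg a.z, norm_nonneg (x : ℂ)]

/-- The action of `L`, hence of `G`, on the disc by Möbius transformations. -/
instance : SMul Cover 𝔻 where
  smul a x := Complex.UnitDisc.mk ((conj a.w * x + a.z) / (conj a.z * x + a.w)) (by
    rw [norm_div, div_lt_one (norm_pos_iff.2 (disc_ne_zero a x))]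
    have h := Cover.norm_identity a.z a.w x 1
    have h1 := a.nrm_pos
    unfold Cover.nrm at h1
    have h2 : 0 < ‖(1 : ℂ)‖ ^ 2 - ‖(x : ℂ)‖ ^ 2 := by
      have := x.sq_norm_lt_one
      rw [norm_one]
      linarith
    have h3 := mul_pos h1 h2
    rw [← h, mul_one, mul_one] at h3
    exact lt_of_pow_lt_pow_left₀ 2 (norm_nonneg _) (by linarith))

theorem coe_smul (a : Cover) (x : 𝔻) :
    ((a • x : 𝔻) : ℂ) = (conj a.w * x + a.z) / (conj a.z * x + a.w) := rfl

instance : MulAction Cover 𝔻 where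
  one_smul x := by
    apply Complex.UnitDisc.coe_injective
    rw [coe_smul, Cover.one_w, Cover.one_z]
    simp
  mul_smul a b x := by
    apply Complex.UnitDisc.coe_injective
    have h1 := disc_ne_zero b x
    have h2 := disc_ne_zero (a * b) x
    have h3 := disc_ne_zero a (b • x)
    rw [coe_smul] at h3
    rw [coe_smul, coe_smul a, coe_smul b, div_eq_div_iff h2 h3]
    simp only [Cover.mul_z, Cover.mul_w, map_add, map_mul, Complex.conj_conj]
    field_simp
    ring

/-- The image of a subgroup of `G` in `PSU(1,1)`, the latter being regarded as a group of
transformations of the disc. -/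
def image (Γ : Subgroup G) : Subgroup (Equiv.Perm 𝔻) := Γ.map (MulAction.toPermHom G 𝔻)

/-- A subgroup of `G` is of finite level `k` if its intersection with the centre of `G` has
index `k` in the centre. -/
def HasLevel (Γ : Subgroup G) (k : ℕ) : Prop :=
  0 < k ∧ Γ.relIndex (Subgroup.center G) = k

/-- The element of `L` over `(x, 1)`, which maps the origin to `x` along the geodesic through these
points. -/
def translation (x : 𝔻) : Cover where
  z := x
  ω := 0
  norm_lt := by simpa using x.norm_lt_one

/-- The element of `L` that acts as `y ↦ exp (i t) y`. -/
def rotationZero (t : ℝ) : Cover where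
  z := 0
  ω := ((-(t / 2) : ℝ) : ℂ) * Complex.I
  norm_lt := by simp

/-- The rotation of the hyperbolic plane about `x` through the angle `t`. -/
def rotation (x : 𝔻) (t : ℝ) : Equiv.Perm 𝔻 :=
  MulAction.toPerm (translation x * rotationZero t * (translation x)⁻¹)

/-! ### Hyperbolic geometry of the disc -/

/-- The hyperbolic distance (curvature `-1`). -/
def hypDist (x y : 𝔻) : ℝ :=
  2 * Real.arsinh (‖(x : ℂ) - y‖ / √((1 - ‖(x : ℂ)‖ ^ 2) * (1 - ‖(y : ℂ)‖ ^ 2)))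

/-- The geodesic segment from `x` to `y`. -/
def hypSegment (x y : 𝔻) : Set 𝔻 := {a | hypDist x a + hypDist a y = hypDist x y}

/-- The angle at `a` between the geodesic rays from `a` to `b` and to `c`: the Euclidean angle
after `a` has been moved to the origin. -/
def hypAngle (a b c : 𝔻) : ℝ :=
  InnerProductGeometry.angle (((translation a)⁻¹ • b : 𝔻) : ℂ) (((translation a)⁻¹ • c : 𝔻) : ℂ)

/-- `u`, `v`, `w` are the vertices of a hyperbolic triangle with angles `π/p`, `π/q`, `π/r`. -/
def IsTriangle (u v w : 𝔻) (p q r : ℕ) : Prop :=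
  u ≠ v ∧ v ≠ w ∧ w ≠ u ∧
    hypAngle u v w = Real.pi / p ∧ hypAngle v w u = Real.pi / q ∧ hypAngle w u v = Real.pi / r

/-- The triangle group generated by the rotations about `u`, `v`, `w` through `2π/p`, `2π/q`,
`2π/r`. -/
def triangleGroup (u v w : 𝔻) (p q r : ℕ) : Subgroup (Equiv.Perm 𝔻) :=
  Subgroup.closure
    {rotation u (2 * Real.pi / p), rotation v (2 * Real.pi / q), rotation w (2 * Real.pi / r)}

/-- The Dirichlet region of `x` with respect to a set `O` of points. -/
def dirichlet (O : Set 𝔻) (x : 𝔻) : Set 𝔻 := {y | ∀ x' ∈ O, hypDist y x ≤ hypDist y x'}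

/-- The edge corona of `Γ` with respect to `u`: the points of the orbit of `u`, other than `u`,
whose Dirichlet region has at least a nondegenerate segment in common with that of `u`. -/
def edgeCorona (Γ : Subgroup (Equiv.Perm 𝔻)) (u : 𝔻) : Set 𝔻 :=
  {x | x ∈ MulAction.orbit Γ u ∧ x ≠ u ∧ ∃ a b : 𝔻, a ≠ b ∧
    hypSegment a b ⊆ dirichlet (MulAction.orbit Γ u) u ∩ dirichlet (MulAction.orbit Γ u) x}

/-! ### The prisms and the fundamental domain -/

/-- The symmetric bilinear form of signature `(2,2)` on `ℂ²`. -/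
def form (a b : ℂ × ℂ) : ℝ := (a.1 * conj b.1 - a.2 * conj b.2).re

/-- `E_g`: the connected component containing `g` of the preimage in `L` of the affine tangent
space of the quadric at the image of `g`. -/
def tangentSpace (g : Cover) : Set Cover :=
  connectedComponentIn {a | form g.proj a.proj = -1} g

/-- `I_g`: the connected component containing `g` of the preimage in `L` of the half-space bounded
by that tangent space and not containing the origin. -/
def halfSpaceI (g : Cover) : Set Cover :=
  connectedComponentIn {a | form g.proj a.proj ≤ -1} g

/-- `H_g`: the closure of the component of `L \ E_g` that is not in `I_g`. -/
def halfSpaceH (g : Cover) : Set Cover := closure (halfSpaceI g)ᶜ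

/-- `Q_x`, the intersection of the half-spaces `H_{g₁g₂}` over all `g₁ ∈ Γ₁` and `g₂ ∈ Γ₂` such
that `g₁` maps `u` to `x`. -/
def prism (Γ₁ Γ₂ : Subgroup G) (u x : 𝔻) : Set Cover :=
  ⋂ g₁ ∈ {g : G | g ∈ Γ₁ ∧ g • u = x}, ⋂ g₂ ∈ Γ₂, halfSpaceH ((g₁ * g₂ : G) : Cover)

/-- The interior of `S ∩ A` relative to the subspace `A`. -/
def interiorIn {X : Type*} [TopologicalSpace X] (A S : Set X) : Set X :=
  Subtype.val '' interior ((Subtype.val : A → X) ⁻¹' S)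

/-- The interior of `E_e ∩ ∂Q_u` (relative to `E_e`) minus the union of the prisms `Q_x`,
`x ∈ N`. -/
def domainInterior (Γ₁ Γ₂ : Subgroup G) (u : 𝔻) (N : Set 𝔻) : Set Cover :=
  interiorIn (tangentSpace 1) (tangentSpace 1 ∩ frontier (prism Γ₁ Γ₂ u u))
    \ ⋃ x ∈ N, prism Γ₁ Γ₂ u x

/-- The interior `F_e°` of the fundamental domain `F_e`: all the prisms over the points of the orbit
of `u` other than `u` are removed. -/
def fundInterior (Γ₁ Γ₂ : Subgroup G) (u : 𝔻) : Set Cover :=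
  domainInterior Γ₁ Γ₂ u (MulAction.orbit Γ₁ u \ {u})

/-- The function `ℓ⁻`, for `L` and `q`. -/
def ellMinus (L : ℝ) (q : ℕ) (t : ℝ) : ℝ :=
  1 / Real.tanh L - 1 / (Real.sinh L * Real.sin (Real.pi / q)) *
    √(1 / t ^ 2 - Real.cos (Real.pi / q) ^ 2)

/-- The secant. -/
def sec (t : ℝ) : ℝ := 1 / Real.cos t

end LorentzBiquotient

end

/-! The projection `(z, w) ↦ y = z / w` maps the cone to the unit disc. If `h` in `G` maps the
origin to `x`, then `|w|` takes the value `|w| |1 - conj x y| / √(1 - |x|²)` at the translate by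
`h⁻¹` of a point over `(z, w)` (`norm_inv_mul_w`). The prism `Q_0` is a polygonal cylinder: by the
level assumptions and Bézout's identity, the lifts of rotations about the origin in `Γ₁` and `Γ₂`
together shift the argument of `w` by all multiples of `2θ`, where `θ = πk/(2p)`. Hence `Q_0`
contains the points with `|w| ≤ 1` (`mem_prism`) and is contained in `|w| ≤ sec θ`
(`norm_le_sec_of_mem_prism`), and correspondingly for the translates of the other prisms to the
origin. A point of `E_e ∩ ∂Q_0` has `t = |w|` in `[1, sec θ]`.

Suppose that such a point lies in no prism over the edge corona. The images of the origin under the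
rotations through `±2π/q` about `v`, and about the images of `v` under the rotations in the triangle
group that fix the origin, have absolute value less than `tanh L₀ ≤ R`, so they belong to the edge
corona. The points `y` that their prisms are certain to cover at the height `t` form Euclidean
discs, and every ray from the origin enters one of these discs at a distance of at most
`ellMinus t`, so that `|y| < ellMinus t` (`exists_rotation_covering`). That the discs close up around
the origin rests on the second law of cosines for the triangle and on `r ≤ q` (`dual_cosine_law`,
`cosh_mul_sin_mul_sin_half_le`).

On the other hand, `t (1 - R * ellMinus t)` decreases with `t`, because `tanh L₀ ≤ R`. By the
assumption on `R` it is at least `sec θ * √(1 - R²)` for `t = sec θ`, hence for all `t` in the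
interval, and therefore `t |1 - conj x y| > sec θ * √(1 - |x|²)` for all `x` with `|x| ≥ R`
(`lt_mul_one_sub_of_lt_ellMinus`). So the point does not lie in the prism over such an `x` either.
-/

noncomputable section

namespace LorentzBiquotient

/-! ### The half-spaces bounded by tangent spaces -/

theorem continuous_coords : Continuous fun a : Cover => (a.z, a.ω) :=
  continuous_induced_dom

theorem continuous_z : Continuous fun a : Cover => a.z := continuous_coords.fst

theorem continuous_ω : Continuous fun a : Cover => a.ω := continuous_coords.snd

theorem continuous_w : Continuous fun a : Cover => a.w :=
  Complex.continuous_exp.comp continuous_ω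

theorem continuous_cover_mul_left (h : Cover) : Continuous fun a : Cover => h * a := by
  refine continuous_induced_rng.2 ?_
  have hq : Continuous fun a : Cover => 1 + Cover.quot h a := by
    unfold Cover.quot
    refine continuous_const.add ((continuous_const.mul continuous_z).div
      (continuous_const.mul continuous_w) fun a => mul_ne_zero h.w_ne_zero a.w_ne_zero)
  refine ((continuous_const.mul continuous_z).add (continuous_const.mul continuous_w)).prodMk
    ((continuous_const.add continuous_ω).add (hq.clog fun a => ?_))
  exact Or.inl (Cover.re_one_add_quot_pos h a)

theorem inv_mul_w {h : Cover} (hn : h.nrm = 1) (a : Cover) :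
    (h⁻¹ * a).w = conj h.w * a.w - conj h.z * a.z := by
  rw [Cover.mul_w, Cover.inv_w, Cover.inv_z, hn]
  simp
  ring

/-- Left translation by an element of `G` preserves the form, and for the unit the form is `-Re w`.
-/
theorem form_proj {h : Cover} (hn : h.nrm = 1) (a : Cover) :
    form h.proj a.proj = -(h⁻¹ * a).w.re := by
  rw [inv_mul_w hn]
  simp only [form, Cover.proj, Complex.sub_re, Complex.mul_re, Complex.conj_re, Complex.conj_im]
  ring

theorem form_le_of_mem_halfSpaceI {h a : Cover} (ha : a ∈ halfSpaceI h) :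
    form h.proj a.proj ≤ -1 := by
  have h1 : halfSpaceI h ⊆ {a | form h.proj a.proj ≤ -1} := connectedComponentIn_subset _ _
  exact h1 ha

theorem form_eq_of_mem_tangentSpace {h a : Cover} (ha : a ∈ tangentSpace h) :
    form h.proj a.proj = -1 := by
  have h1 : tangentSpace h ⊆ {a | form h.proj a.proj = -1} := connectedComponentIn_subset _ _
  exact h1 ha

/-- The point of the cover over `(z, w)` whose argument is the principal one. -/
def principalLift (z w : ℂ) (h : ‖z‖ < ‖w‖) : Cover where
  z := z
  ω := Complex.log w
  norm_lt := by
    rwa [Complex.exp_log (norm_pos_iff.1 ((norm_nonneg z).trans_lt h))]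

/-- These points form a connected part of `I_e` (in fact all of it), since the part `Re w ≥ 1` of the
cone is star-shaped with respect to `(0, 1)`. -/
theorem isPreconnected_halfSpace_one :
    IsPreconnected {a : Cover | |a.ω.im| < Real.pi / 2 ∧ 1 ≤ a.w.re} := by
  set K : Set (ℂ × ℂ) := {p | ‖p.1‖ < ‖p.2‖ ∧ 1 ≤ p.2.re} with hK
  have hstar : StarConvex ℝ ((0, 1) : ℂ × ℂ) K := by
    rintro ⟨z, w⟩ ⟨h1, h2⟩ a b ha hb hab
    simp only at h1 h2
    simp only [hK, Set.mem_ofPred_eq, Prod.smul_mk, Prod.mk_add_mk, smul_zero, zero_add,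
      Complex.real_smul, mul_one]
    constructor
    · rcases hb.eq_or_lt with rfl | hb'
      · have : a = 1 := by linarith
        simp [this]
      · have h3 : ‖(b : ℂ) * w‖ ≤ ‖(a : ℂ) + b * w‖ := by
          refine le_of_sq_le_sq ?_ (norm_nonneg _)
          simp only [← Complex.normSq_eq_norm_sq, Complex.normSq_apply, Complex.add_re,
            Complex.add_im, Complex.mul_re, Complex.mul_im, Complex.ofReal_re, Complex.ofReal_im]
          nlinarith [mul_nonneg (mul_nonneg ha hb) (zero_le_one.trans h2), sq_nonneg a]
        refine lt_of_lt_of_le ?_ h3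
        rw [norm_mul, norm_mul]
        exact mul_lt_mul_of_pos_left h1 (by simpa using hb'.ne')
    · simp only [Complex.add_re, Complex.mul_re, Complex.ofReal_re, Complex.ofReal_im]
      nlinarith
  have hconn : IsPreconnected K :=
    (hstar.isPathConnected ⟨by simp, by simp⟩).isConnected.isPreconnected
  have : PreconnectedSpace K := Subtype.preconnectedSpace hconn
  let φ : K → Cover := fun p => principalLift p.1.1 p.1.2 p.2.1
  have hφ : Continuous φ := by
    refine continuous_induced_rng.2 ?_
    refine (continuous_subtype_val.fst).prodMk ((continuous_subtype_val.snd).clog fun p => ?_)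
    exact Or.inl (zero_lt_one.trans_le p.2.2)
  have hrange : {a : Cover | |a.ω.im| < Real.pi / 2 ∧ 1 ≤ a.w.re} = Set.range φ := by
    ext a
    constructor
    · rintro ⟨h1, h2⟩
      refine ⟨⟨(a.z, a.w), a.norm_lt', h2⟩, ?_⟩
      have h3 := abs_lt.1 h1
      have hpi := Real.pi_pos
      exact Cover.ext rfl (Complex.log_exp (by linarith) (by linarith))
    · rintro ⟨p, rfl⟩
      have h1 : (0 : ℝ) < p.1.2.re := zero_lt_one.trans_le p.2.2
      have h0 : p.1.2 ≠ 0 := by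
        rintro h
        simp [h] at h1
      refine ⟨?_, ?_⟩
      · change |(Complex.log p.1.2).im| < _
        rw [Complex.log_im]
        exact Complex.abs_arg_lt_pi_div_two_iff.2 (Or.inl h1)
      · change 1 ≤ (Complex.exp (Complex.log p.1.2)).re
        rw [Complex.exp_log h0]
        exact p.2.2
  rw [hrange]
  exact isPreconnected_range hφ

/-- The interior of `I_h` contains the translate by `h` of the points with `Re w > 1` whose argument
lies in `(-π/2, π/2)`. -/
theorem notMem_halfSpaceH {h a : Cover} (hn : h.nrm = 1)
    (h1 : |(h⁻¹ * a).ω.im| < Real.pi / 2) (h2 : 1 < (h⁻¹ * a).w.re) : a ∉ halfSpaceH h := by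
  set U : Set Cover := {b | |(h⁻¹ * b).ω.im| < Real.pi / 2 ∧ 1 < (h⁻¹ * b).w.re} with hU
  have hopen : IsOpen U := by
    have hc := continuous_cover_mul_left h⁻¹
    exact (isOpen_lt ((Complex.continuous_im.comp (continuous_ω.comp hc)).abs)
      continuous_const).inter
      (isOpen_lt continuous_const (Complex.continuous_re.comp (continuous_w.comp hc)))
  have hsub : U ⊆ halfSpaceI h := by
    have hpre := isPreconnected_halfSpace_one.image (fun a => h * a)
      (continuous_cover_mul_left h).continuousOn
    have hmem : (fun a => h * a) '' {a : Cover | |a.ω.im| < Real.pi / 2 ∧ 1 ≤ a.w.re} ⊆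
        halfSpaceI h := by
      refine hpre.subset_connectedComponentIn ⟨1, ⟨?_, ?_⟩, mul_one h⟩ ?_
      · simp [Cover.one_ω, Real.pi_pos]
      · simp [Cover.one_w]
      · rintro _ ⟨b, ⟨-, hb⟩, rfl⟩
        change form h.proj (h * b).proj ≤ -1
        rw [form_proj hn, inv_mul_cancel_left]
        linarith
    refine fun b hb => hmem ⟨h⁻¹ * b, ⟨hb.1, hb.2.le⟩, mul_inv_cancel_left h b⟩
  intro ha
  obtain ⟨b, hbU, hbI⟩ := mem_closure_iff.1 ha U hopen ⟨h1, h2⟩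
  exact hbI (hsub hbU)

/-- The image of `a` under the homothety of ratio `exp (-s)`. -/
def shrink (a : Cover) (s : ℝ) : Cover where
  z := Complex.exp (-s) * a.z
  ω := -s + a.ω
  norm_lt := by
    rw [Complex.exp_add, norm_mul, norm_mul]
    exact mul_lt_mul_of_pos_left a.norm_lt (norm_pos_iff.2 (Complex.exp_ne_zero _))

theorem shrink_w (a : Cover) (s : ℝ) : (shrink a s).w = Complex.exp (-s) * a.w :=
  Complex.exp_add _ _

/-- No connectedness is involved here: a point with `Re w ≤ 1` is a limit of the points below it on
its ray, and these violate the inequality that defines the half-space. -/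
theorem mem_halfSpaceH {h a : Cover} (hn : h.nrm = 1) (h1 : (h⁻¹ * a).w.re ≤ 1) :
    a ∈ halfSpaceH h := by
  have hlim : Filter.Tendsto (shrink a) (nhdsWithin 0 (Set.Ioi 0)) (nhds a) := by
    have hc : Continuous (shrink a) := by
      refine continuous_induced_rng.2 ?_
      change Continuous fun s : ℝ => (Complex.exp (-s) * a.z, -(s : ℂ) + a.ω)
      fun_prop
    have h0 : shrink a 0 = a := by
      apply Cover.ext <;> simp [shrink]
    simpa only [h0] using (hc.tendsto 0).mono_left nhdsWithin_le_nhds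
  refine mem_closure_of_tendsto hlim ?_
  filter_upwards [self_mem_nhdsWithin] with s hs
  intro hI
  have h2 : form h.proj (shrink a s).proj ≤ -1 := form_le_of_mem_halfSpaceI hI
  have h3 : (h⁻¹ * shrink a s).w = (Real.exp (-s) : ℝ) * (h⁻¹ * a).w := by
    rw [inv_mul_w hn, inv_mul_w hn, shrink_w]
    change _ - conj h.z * (Complex.exp (-s) * a.z) = _
    push_cast
    ring
  rw [form_proj hn, h3, Complex.re_ofReal_mul] at h2
  have h4 : Real.exp (-s) < 1 := by
    rw [← Real.exp_zero]
    exact Real.exp_lt_exp.2 (by simpa using hs)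
  nlinarith [Real.exp_pos (-s)]

theorem isClosed_halfSpaceH (h : Cover) : IsClosed (halfSpaceH h) := isClosed_closure

theorem nrm_one : (1 : Cover).nrm = 1 := by simp [Cover.nrm, Cover.one_w, Cover.one_z]

theorem re_w_of_mem_tangentSpace {a : Cover} (ha : a ∈ tangentSpace 1) : a.w.re = 1 := by
  have h : form (1 : Cover).proj a.proj = -1 := form_eq_of_mem_tangentSpace ha
  rw [form_proj nrm_one] at h
  simpa using h

/-! ### Subgroups of finite level -/

/-- The element of `G` over `(0, exp (i θ))`, which acts as the rotation about the origin through
`-2θ`. These elements form the one-parameter subgroup of `G` that fixes the origin. -/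
def rot (θ : ℝ) : G :=
  ⟨{ z := 0
     ω := (θ : ℂ) * Complex.I
     norm_lt := by simp }, by
    change Cover.nrm _ = 1
    simp [Cover.nrm, Cover.w, Complex.norm_exp_ofReal_mul_I]⟩

theorem rot_z (θ : ℝ) : (rot θ : Cover).z = 0 := rfl

theorem rot_ω (θ : ℝ) : (rot θ : Cover).ω = (θ : ℂ) * Complex.I := rfl

theorem rot_w (θ : ℝ) : (rot θ : Cover).w = Complex.exp ((θ : ℂ) * Complex.I) := rfl

theorem rot_add (s t : ℝ) : rot (s + t) = rot s * rot t := by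
  apply Subtype.ext
  apply Cover.ext
  · simp [Cover.mul_z, rot_z]
  · simp [Cover.mul_ω, rot_ω, Cover.quot, rot_z]
    ring

theorem rot_zero : rot 0 = 1 := by
  apply Subtype.ext
  apply Cover.ext
  · simp [rot_z, Cover.one_z]
  · simp [rot_ω, Cover.one_ω]

theorem rot_neg (t : ℝ) : rot (-t) = (rot t)⁻¹ := by
  rw [eq_inv_iff_mul_eq_one, ← rot_add, neg_add_cancel, rot_zero]

theorem rot_pow (t : ℝ) (n : ℕ) : rot t ^ n = rot (n * t) := by
  induction n with
  | zero => simp [rot_zero]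
  | succ n ih => rw [pow_succ, ih, ← rot_add]; congr 1; push_cast; ring

theorem rot_zpow (t : ℝ) (n : ℤ) : rot t ^ n = rot (n * t) := by
  cases n with
  | ofNat n => simpa using rot_pow t n
  | negSucc n =>
    rw [zpow_negSucc, rot_pow, ← rot_neg]
    congr 1
    push_cast
    ring

theorem exists_eq_rot {g : G} (hg : (g : Cover).z = 0) : ∃ θ, g = rot θ := by
  refine ⟨(g : Cover).ω.im, Subtype.ext (Cover.ext hg ?_)⟩
  have h : (g : Cover).nrm = 1 := g.2
  rw [Cover.nrm, hg, Cover.w, Complex.norm_exp] at h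
  have h1 : Real.exp (g : Cover).ω.re = 1 := by
    rw [norm_zero] at h
    nlinarith [Real.exp_pos (g : Cover).ω.re]
  rw [Real.exp_eq_one_iff] at h1
  rw [rot_ω]
  apply Complex.ext <;> simp [h1]

theorem rot_pi_mem_center : rot Real.pi ∈ Subgroup.center G := by
  refine Subgroup.mem_center_iff.2 fun g => Subtype.ext (Cover.ext ?_ ?_)
  · simp [Cover.mul_z, rot_z, rot_w]
  · simp [Cover.mul_ω, rot_ω, Cover.quot, rot_z]
    ring

theorem HasLevel.rot_mem {Γ : Subgroup G} {k : ℕ} (h : HasLevel Γ k) :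
    rot (k * Real.pi) ∈ Γ := by
  have h1 : (⟨rot Real.pi, rot_pi_mem_center⟩ : Subgroup.center G) ^ k ∈
      Γ.subgroupOf (Subgroup.center G) := by
    rw [← h.2]
    exact Subgroup.pow_index_mem _ _
  rw [Subgroup.mem_subgroupOf] at h1
  simpa [rot_pow] using h1

theorem smul_zero_eq (a : Cover) : ((a • (0 : 𝔻) : 𝔻) : ℂ) = a.z / a.w := by
  simp [coe_smul]

theorem translation_zero : translation 0 = 1 :=
  Cover.ext (by simp [translation, Cover.one_z]) (by simp [translation, Cover.one_ω])

theorem coe_rotation_zero (t : ℝ) (x : 𝔻) :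
    ((rotation 0 t x : 𝔻) : ℂ) = Complex.exp (t * Complex.I) * x := by
  have h : rotation 0 t x = rotationZero t • x := by
    rw [rotation, translation_zero]
    simp
  have hw : (rotationZero t).w = Complex.exp (((-(t / 2) : ℝ) : ℂ) * Complex.I) := rfl
  have hz : (rotationZero t).z = 0 := rfl
  rw [h, coe_smul, hw, hz, ← Complex.exp_conj]
  simp only [map_zero, zero_mul, zero_add, add_zero, map_mul, Complex.conj_ofReal, Complex.conj_I]
  rw [mul_div_right_comm, ← Complex.exp_sub]
  congr 2
  push_cast
  ring

theorem coe_rot_smul (θ : ℝ) (x : 𝔻) :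
    ((rot θ • x : 𝔻) : ℂ) = Complex.exp (-(2 * θ : ℝ) * Complex.I) * x := by
  change (((rot θ : Cover) • x : 𝔻) : ℂ) = _
  rw [coe_smul, rot_w, rot_z, ← Complex.exp_conj]
  simp only [map_zero, zero_mul, zero_add, add_zero, map_mul, Complex.conj_ofReal, Complex.conj_I]
  rw [mul_div_right_comm, ← Complex.exp_sub]
  congr 2
  push_cast
  ring

theorem rot_smul_zero (θ : ℝ) : rot θ • (0 : 𝔻) = 0 := by
  apply Complex.UnitDisc.coe_injective
  rw [coe_rot_smul]
  simp

/-- A lift of the rotation about the origin through `2π/n` is `rot` of an angle `-π/n - mπ`;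
together with the central element `rot (kπ)` it generates `rot (kπ/n)`. -/
theorem HasLevel.rot_div_mem {Γ : Subgroup G} {k n : ℕ} (h : HasLevel Γ k) (hn : 0 < n)
    (hrot : rotation 0 (2 * Real.pi / n) ∈ image Γ) : rot (k * Real.pi / n) ∈ Γ := by
  have hnR : (n : ℝ) ≠ 0 := by exact_mod_cast hn.ne'
  obtain ⟨g, hg, hgr⟩ := hrot
  have hact : ∀ x : 𝔻, g • x = rotation 0 (2 * Real.pi / n) x := fun x => by rw [← hgr]; rfl
  have hz : (g : Cover).z = 0 := by
    have h1 := congrArg Complex.UnitDisc.coe (hact 0)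
    rw [coe_rotation_zero] at h1
    have h2 : (g : Cover).z / (g : Cover).w = 0 := by
      rw [← smul_zero_eq]
      rw [Complex.UnitDisc.coe_zero, mul_zero] at h1
      exact h1
    simpa [(g : Cover).w_ne_zero] using h2
  obtain ⟨θ, rfl⟩ := exists_eq_rot hz
  -- Any nonzero point of the disc determines the angle of the rotation.
  have h1 := congrArg Complex.UnitDisc.coe (hact (Complex.UnitDisc.mk (1 / 2) (by norm_num)))
  rw [coe_rotation_zero, coe_rot_smul, Complex.UnitDisc.coe_mk] at h1
  have h2 := mul_right_cancel₀ (by norm_num) h1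
  obtain ⟨m, hm⟩ := Complex.exp_eq_exp_iff_exists_int.1 h2
  have him := congrArg Complex.im hm
  have hθ : θ = -(Real.pi / n) - m * Real.pi := by
    simp at him
    linear_combination (-1 / 2) * him
  have hcomb : rot (k * Real.pi / n) = rot θ ^ (-(k : ℤ)) * rot (k * Real.pi) ^ (-m) := by
    rw [rot_zpow, rot_zpow, ← rot_add, hθ]
    congr 1
    push_cast
    field_simp
    ring
  rw [hcomb]
  exact Γ.mul_mem (Γ.zpow_mem hg _) (Γ.zpow_mem h.rot_mem _)

/-- The angles `kπ/p₁` and `kπ/p₂` generate `kπ/p` for the least common multiple `p`. -/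
theorem exists_rot_mul_rot {Γ₁ Γ₂ : Subgroup G} {k p₁ p₂ : ℕ} (hp₁ : 0 < p₁) (hp₂ : 0 < p₂)
    (h₁ : rot (k * Real.pi / p₁) ∈ Γ₁) (h₂ : rot (k * Real.pi / p₂) ∈ Γ₂) (n : ℤ) :
    ∃ s t : ℝ, rot s ∈ Γ₁ ∧ rot t ∈ Γ₂ ∧ s + t = n * (k * Real.pi / Nat.lcm p₁ p₂) := by
  have hb := Nat.gcd_eq_gcd_ab p₁ p₂
  have hl := Nat.gcd_mul_lcm p₁ p₂
  have hl0 : (Nat.lcm p₁ p₂ : ℝ) ≠ 0 := by exact_mod_cast (Nat.lcm_pos hp₁ hp₂).ne'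
  have hb' : (Nat.gcd p₁ p₂ : ℝ) = p₁ * (Nat.gcdA p₁ p₂ : ℤ) + p₂ * (Nat.gcdB p₁ p₂ : ℤ) := by
    exact_mod_cast hb
  have hl' : (Nat.gcd p₁ p₂ : ℝ) * Nat.lcm p₁ p₂ = p₁ * p₂ := by exact_mod_cast hl
  have hp₁' : (p₁ : ℝ) ≠ 0 := by exact_mod_cast hp₁.ne'
  have hp₂' : (p₂ : ℝ) ≠ 0 := by exact_mod_cast hp₂.ne'
  refine ⟨_, _, rot_zpow _ _ ▸ Γ₁.zpow_mem h₁ (n * Nat.gcdB p₁ p₂),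
    rot_zpow _ _ ▸ Γ₂.zpow_mem h₂ (n * Nat.gcdA p₁ p₂), ?_⟩
  push_cast
  rw [div_eq_mul_inv _ (Nat.lcm p₁ p₂ : ℝ)]
  have h : ((Nat.lcm p₁ p₂ : ℕ) : ℝ)⁻¹ = Nat.gcd p₁ p₂ / (p₁ * p₂) := by
    rw [← hl', eq_div_iff (by rw [hl']; positivity)]
    field_simp
  rw [h, hb']
  field_simp
  ring

/-! ### The triangle -/

theorem sinh_cosh_hypDist (v : 𝔻) : Real.sinh (hypDist 0 v) = 2 * ‖(v : ℂ)‖ / (1 - ‖(v : ℂ)‖ ^ 2) ∧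
    Real.cosh (hypDist 0 v) = (1 + ‖(v : ℂ)‖ ^ 2) / (1 - ‖(v : ℂ)‖ ^ 2) := by
  have hv : 0 < 1 - ‖(v : ℂ)‖ ^ 2 := by linarith [v.sq_norm_lt_one]
  have hs := Real.sq_sqrt hv.le
  have hs0 := Real.sqrt_pos.2 hv
  have hsinh : Real.sinh (Real.arsinh (‖(v : ℂ)‖ / √(1 - ‖(v : ℂ)‖ ^ 2))) =
      ‖(v : ℂ)‖ / √(1 - ‖(v : ℂ)‖ ^ 2) := Real.sinh_arsinh _
  have hcosh : Real.cosh (Real.arsinh (‖(v : ℂ)‖ / √(1 - ‖(v : ℂ)‖ ^ 2))) =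
      1 / √(1 - ‖(v : ℂ)‖ ^ 2) := by
    rw [Real.cosh_arsinh, div_pow, hs, ← Real.sqrt_one, ← Real.sqrt_div zero_le_one, Real.sqrt_one]
    congr 1
    field_simp
    ring
  have hd : hypDist 0 v = 2 * Real.arsinh (‖(v : ℂ)‖ / √(1 - ‖(v : ℂ)‖ ^ 2)) := by
    simp [hypDist]
  rw [hd, Real.sinh_two_mul, Real.cosh_two_mul, hsinh, hcosh]
  constructor
  · field_simp
    rw [hs]
  · rw [div_pow, div_pow, hs]
    ring

theorem sinh_hypDist (v : 𝔻) :
    Real.sinh (hypDist 0 v) = 2 * ‖(v : ℂ)‖ / (1 - ‖(v : ℂ)‖ ^ 2) := (sinh_cosh_hypDist v).1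

theorem cosh_hypDist (v : 𝔻) :
    Real.cosh (hypDist 0 v) = (1 + ‖(v : ℂ)‖ ^ 2) / (1 - ‖(v : ℂ)‖ ^ 2) := (sinh_cosh_hypDist v).2

theorem translation_nrm_pos (v : 𝔻) : ((translation v).nrm : ℂ) ≠ 0 := by
  exact_mod_cast (translation v).nrm_pos.ne'

theorem coe_inv_translation_smul (v x : 𝔻) :
    (((translation v)⁻¹ • x : 𝔻) : ℂ) = (x - v) / (1 - conj (v : ℂ) * x) := by
  have hn := translation_nrm_pos v
  have hw : (translation v).w = 1 := by simp [Cover.w, translation]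
  have hz : (translation v).z = v := rfl
  rw [coe_smul, Cover.inv_w, Cover.inv_z, hw, hz]
  simp only [map_one, map_div₀, map_neg, Complex.conj_ofReal]
  have h : 1 - conj (v : ℂ) * x ≠ 0 := by
    have := disc_ne_zero (translation v)⁻¹ x
    rw [Cover.inv_w, Cover.inv_z, hw, hz] at this
    simp only [map_one, map_div₀, map_neg, Complex.conj_ofReal] at this
    intro h
    apply this
    field_simp
    linear_combination h
  have h' : -conj (v : ℂ) / (translation v).nrm * x + 1 / (translation v).nrm =
      (1 - conj (v : ℂ) * x) / (translation v).nrm := by ring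
  rw [h']
  field_simp
  ring

theorem one_sub_conj_mul_ne_zero (v x : 𝔻) : 1 - conj (v : ℂ) * x ≠ 0 := by
  intro h
  have h1 : ‖conj (v : ℂ) * (x : ℂ)‖ = 1 := by
    rw [← sub_eq_zero.1 h, norm_one]
  rw [norm_mul, Complex.norm_conj] at h1
  nlinarith [v.norm_lt_one, x.norm_lt_one, norm_nonneg (v : ℂ), norm_nonneg (x : ℂ)]

theorem inner_inv_translation (v w : 𝔻) :
    inner ℝ (((translation v)⁻¹ • w : 𝔻) : ℂ) (((translation v)⁻¹ • (0 : 𝔻) : 𝔻) : ℂ) =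
      (‖(v : ℂ)‖ ^ 2 * (1 + ‖(w : ℂ)‖ ^ 2) - inner ℝ (v : ℂ) (w : ℂ) * (1 + ‖(v : ℂ)‖ ^ 2)) /
        ‖1 - conj (v : ℂ) * w‖ ^ 2 := by
  rw [coe_inv_translation_smul, coe_inv_translation_smul, Complex.inner, Complex.inner]
  have h0 : Complex.normSq (1 - conj (v : ℂ) * w) ≠ 0 :=
    (Complex.normSq_pos.2 (one_sub_conj_mul_ne_zero v w)).ne'
  simp only [Complex.UnitDisc.coe_zero, mul_zero, sub_zero, zero_sub, div_one,
    ← Complex.normSq_eq_norm_sq]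
  rw [map_div₀, eq_div_iff h0, ← Complex.re_mul_ofReal]
  have h1 : (Complex.normSq (1 - conj (v : ℂ) * w) : ℂ) =
      conj (1 - conj (v : ℂ) * w) * (1 - conj (v : ℂ) * w) := by
    rw [Complex.normSq_eq_conj_mul_self]
  have h2 : conj (1 - conj (v : ℂ) * w) ≠ 0 := by
    exact (map_ne_zero _).2 (one_sub_conj_mul_ne_zero v w)
  rw [h1]
  have h3 : -(v : ℂ) * (conj ((w : ℂ) - v) / conj (1 - conj (v : ℂ) * w)) *
      (conj (1 - conj (v : ℂ) * w) * (1 - conj (v : ℂ) * w)) =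
      -(v : ℂ) * conj ((w : ℂ) - v) * (1 - conj (v : ℂ) * w) := by
    generalize conj (1 - conj (v : ℂ) * w) = d at h2
    field_simp
  rw [h3]
  simp only [Complex.normSq_apply, Complex.mul_re, Complex.mul_im, Complex.sub_re, Complex.sub_im,
    Complex.neg_re, Complex.neg_im, Complex.conj_re, Complex.conj_im, Complex.one_re,
    Complex.one_im, map_sub]
  ring

theorem norm_sub_sq_eq (v w : ℂ) :
    ‖w - v‖ ^ 2 = ‖v‖ ^ 2 + ‖w‖ ^ 2 - 2 * inner ℝ v w := by
  simp only [Complex.inner, ← Complex.normSq_eq_norm_sq, Complex.normSq_apply, Complex.sub_re,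
    Complex.sub_im, Complex.mul_re, Complex.conj_re, Complex.conj_im]
  ring

theorem norm_one_sub_conj_mul_sq (v w : ℂ) :
    ‖1 - conj v * w‖ ^ 2 = 1 - 2 * inner ℝ v w + ‖v‖ ^ 2 * ‖w‖ ^ 2 := by
  simp only [Complex.inner, ← Complex.normSq_eq_norm_sq, Complex.normSq_apply, Complex.sub_re,
    Complex.sub_im, Complex.mul_re, Complex.mul_im, Complex.conj_re, Complex.conj_im,
    Complex.one_re, Complex.one_im]
  ring

/-- The second hyperbolic law of cosines, for a triangle with a vertex at the origin. -/
theorem dual_cosine_law {v w : 𝔻} (hv : v ≠ 0) (hw : w ≠ 0) (hvw : v ≠ w) :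
    Real.cosh (hypDist 0 v) * Real.sin (hypAngle 0 v w) * Real.sin (hypAngle v w 0) =
      Real.cos (hypAngle 0 v w) * Real.cos (hypAngle v w 0) + Real.cos (hypAngle w 0 v) := by
  have hN := norm_pos_iff.2 (one_sub_conj_mul_ne_zero v w)
  have hv' : 0 < ‖(v : ℂ)‖ := norm_pos_iff.2 (by simpa using hv)
  have hw' : 0 < ‖(w : ℂ)‖ := norm_pos_iff.2 (by simpa using hw)
  have hD : 0 < ‖(w : ℂ) - v‖ :=
    norm_pos_iff.2 (sub_ne_zero.2 fun h => hvw (Complex.UnitDisc.coe_injective h).symm)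
  have hv1 : 0 < 1 - ‖(v : ℂ)‖ ^ 2 := by linarith [v.sq_norm_lt_one]
  have hDsq := norm_sub_sq_eq (v : ℂ) w
  have hNsq := norm_one_sub_conj_mul_sq (v : ℂ) w
  have hnx : ‖(((translation v)⁻¹ • w : 𝔻) : ℂ)‖ = ‖(w : ℂ) - v‖ / ‖1 - conj (v : ℂ) * w‖ := by
    rw [coe_inv_translation_smul, norm_div]
  have hny : ∀ a : 𝔻, ‖(((translation a)⁻¹ • (0 : 𝔻) : 𝔻) : ℂ)‖ = ‖(a : ℂ)‖ := by
    intro a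
    rw [coe_inv_translation_smul]
    simp
  have hNc : ‖1 - conj (w : ℂ) * v‖ = ‖1 - conj (v : ℂ) * w‖ := by
    rw [← Complex.norm_conj]
    simp [mul_comm]
  have hnz : ‖(((translation w)⁻¹ • v : 𝔻) : ℂ)‖ = ‖(w : ℂ) - v‖ / ‖1 - conj (v : ℂ) * w‖ := by
    rw [coe_inv_translation_smul, norm_div, norm_sub_rev, hNc]
  have hixy := inner_inv_translation v w
  have hizy := inner_inv_translation w v
  rw [hNc, real_inner_comm (v : ℂ) (w : ℂ)] at hizy
  have hA : hypAngle 0 v w = InnerProductGeometry.angle (v : ℂ) (w : ℂ) := by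
    simp [hypAngle, translation_zero]
  have hCS : 0 ≤ ‖(v : ℂ)‖ ^ 2 * ‖(w : ℂ)‖ ^ 2 - inner ℝ (v : ℂ) (w : ℂ) ^ 2 := by
    have := real_inner_mul_inner_self_le (v : ℂ) (w : ℂ)
    rw [real_inner_self_eq_norm_sq, real_inner_self_eq_norm_sq] at this
    linarith
  have hsA : Real.sin (hypAngle 0 v w) * (‖(v : ℂ)‖ * ‖(w : ℂ)‖) =
      √(‖(v : ℂ)‖ ^ 2 * ‖(w : ℂ)‖ ^ 2 - inner ℝ (v : ℂ) (w : ℂ) ^ 2) := by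
    rw [hA, InnerProductGeometry.sin_angle_mul_norm_mul_norm, real_inner_self_eq_norm_sq,
      real_inner_self_eq_norm_sq]
    congr 1
    ring
  have hsB : Real.sin (hypAngle v w 0) * (‖(w : ℂ) - v‖ / ‖1 - conj (v : ℂ) * w‖ * ‖(v : ℂ)‖) =
      (1 - ‖(v : ℂ)‖ ^ 2) *
        √(‖(v : ℂ)‖ ^ 2 * ‖(w : ℂ)‖ ^ 2 - inner ℝ (v : ℂ) (w : ℂ) ^ 2) /
        ‖1 - conj (v : ℂ) * w‖ ^ 2 := by
    rw [← hnx, ← hny v, hypAngle, InnerProductGeometry.sin_angle_mul_norm_mul_norm,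
      real_inner_self_eq_norm_sq, real_inner_self_eq_norm_sq, hnx, hny, hixy]
    rw [← Real.sqrt_sq hv1.le, ← Real.sqrt_mul (sq_nonneg _),
      ← Real.sqrt_sq (sq_nonneg ‖1 - conj (v : ℂ) * w‖),
      ← Real.sqrt_div (mul_nonneg (sq_nonneg _) hCS)]
    congr 1
    rw [Real.sqrt_sq (sq_nonneg ‖1 - conj (v : ℂ) * w‖)]
    have hN2 : ‖1 - conj (v : ℂ) * w‖ ^ 2 ≠ 0 := by positivity
    rw [div_pow, hDsq]
    rw [hNsq] at hN2 ⊢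
    field_simp
    ring
  have hcA : Real.cos (hypAngle 0 v w) = inner ℝ (v : ℂ) (w : ℂ) / (‖(v : ℂ)‖ * ‖(w : ℂ)‖) := by
    rw [hA, InnerProductGeometry.cos_angle]
  have hcB : Real.cos (hypAngle v w 0) = _ := InnerProductGeometry.cos_angle _ _
  have hcC : Real.cos (hypAngle w 0 v) = _ := InnerProductGeometry.cos_angle _ _
  rw [real_inner_comm, hnz, hny, hizy] at hcC
  rw [hnx, hny, hixy] at hcB
  rw [← eq_div_iff (by positivity)] at hsA hsB
  rw [hcA, hcB, hcC, hsA, hsB, cosh_hypDist]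
  set Δ := √(‖(v : ℂ)‖ ^ 2 * ‖(w : ℂ)‖ ^ 2 - inner ℝ (v : ℂ) (w : ℂ) ^ 2) with hΔ
  have hΔ2 : Δ ^ 2 = ‖(v : ℂ)‖ ^ 2 * ‖(w : ℂ)‖ ^ 2 - inner ℝ (v : ℂ) (w : ℂ) ^ 2 :=
    Real.sq_sqrt hCS
  field_simp
  rw [hΔ2]
  ring

/-- The triangle with angles `π/p`, `π/2`, `π/2` is not hyperbolic. -/
theorem three_le_of_dual_cosine_law {L : ℝ} {p q r : ℕ} (hp : 2 ≤ p) (hr : 2 ≤ r) (hrq : r ≤ q)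
    (h : Real.cosh L * Real.sin (Real.pi / p) * Real.sin (Real.pi / q) =
      Real.cos (Real.pi / p) * Real.cos (Real.pi / q) + Real.cos (Real.pi / r)) : 3 ≤ q := by
  by_contra! hq
  obtain rfl : q = 2 := by omega
  obtain rfl : r = 2 := by omega
  have hp' : (2 : ℝ) ≤ p := by exact_mod_cast hp
  have hpos : 0 < Real.sin (Real.pi / p) := by
    refine Real.sin_pos_of_pos_of_lt_pi (by positivity) ?_
    rw [div_lt_iff₀ (by linarith)]
    nlinarith [Real.pi_pos]
  push_cast at h
  rw [Real.cos_pi_div_two, Real.sin_pi_div_two] at h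
  nlinarith [Real.cosh_pos L, mul_pos (Real.cosh_pos L) hpos]

/-- The perpendicular from the vertex with the angle `π/p` to the opposite side makes an angle `α`
with the side of length `L`, where `cosh L = cot (π/q) cot α`. The inequality says that
`α ≥ π/(2p)`, which holds because the angle `π/r` is at least `π/q`. -/
theorem cosh_mul_sin_mul_sin_half_le {L : ℝ} {p q r : ℕ} (hp : 2 ≤ p) (hr : 2 ≤ r) (hrq : r ≤ q)
    (h : Real.cosh L * Real.sin (Real.pi / p) * Real.sin (Real.pi / q) =
      Real.cos (Real.pi / p) * Real.cos (Real.pi / q) + Real.cos (Real.pi / r)) :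
    Real.cosh L * Real.sin (Real.pi / q) * Real.sin (Real.pi / p / 2) ≤
      Real.cos (Real.pi / q) * Real.cos (Real.pi / p / 2) := by
  have hpi := Real.pi_pos
  have hp' : (2 : ℝ) ≤ p := by exact_mod_cast hp
  have hr' : (2 : ℝ) ≤ r := by exact_mod_cast hr
  have hrq' : (r : ℝ) ≤ q := by exact_mod_cast hrq
  have hple : Real.pi / p ≤ Real.pi / 2 := by gcongr
  have hppos : 0 < Real.pi / p := by positivity
  have hcr : Real.cos (Real.pi / r) ≤ Real.cos (Real.pi / q) := by
    refine Real.cos_le_cos_of_nonneg_of_le_pi (by positivity) ?_ (by gcongr)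
    rw [div_le_iff₀ (by linarith)]
    nlinarith
  have hc : 0 < Real.cos (Real.pi / p / 2) :=
    Real.cos_pos_of_mem_Ioo ⟨by linarith, by linarith⟩
  have hs2 := Real.sin_two_mul (Real.pi / p / 2)
  have hc2 := Real.cos_two_mul (Real.pi / p / 2)
  rw [mul_div_cancel₀ _ (two_ne_zero : (2 : ℝ) ≠ 0)] at hs2 hc2
  rw [hs2, hc2] at h
  refine le_of_mul_le_mul_right ?_ hc
  nlinarith

/-! ### The images of the origin under rotations about the vertices -/

theorem rotationZero_add (s t : ℝ) :
    rotationZero (s + t) = rotationZero s * rotationZero t := by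
  apply Cover.ext
  · simp [Cover.mul_z, rotationZero]
  · simp [Cover.mul_ω, rotationZero, Cover.quot]
    ring

theorem rotation_add (x : 𝔻) (s t : ℝ) : rotation x (s + t) = rotation x s * rotation x t := by
  have h : translation x * rotationZero (s + t) * (translation x)⁻¹ =
      (translation x * rotationZero s * (translation x)⁻¹) *
        (translation x * rotationZero t * (translation x)⁻¹) := by
    rw [rotationZero_add]
    group
  rw [rotation, h]
  exact (MulAction.toPermHom Cover 𝔻).map_mul _ _

/-- The rotations about a point, as a one-parameter group. -/
def rotationHom (x : 𝔻) : Multiplicative ℝ →* Equiv.Perm 𝔻 :=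
  MonoidHom.mk' (fun t => rotation x t.toAdd) fun s t => rotation_add x s.toAdd t.toAdd

theorem rotation_zpow (x : 𝔻) (t : ℝ) (n : ℤ) : rotation x t ^ n = rotation x (n * t) := by
  have h := map_zpow (rotationHom x) (Multiplicative.ofAdd t) n
  rw [← ofAdd_zsmul, zsmul_eq_mul] at h
  exact h.symm

theorem coe_rotation_apply_zero (v : 𝔻) (t : ℝ) :
    ((rotation v t 0 : 𝔻) : ℂ) =
      v * (1 - Complex.exp (t * Complex.I)) /
        (1 - (‖(v : ℂ)‖ ^ 2 : ℝ) * Complex.exp (t * Complex.I)) := by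
  have h : rotation v t 0 = translation v • (rotationZero t • ((translation v)⁻¹ • (0 : 𝔻))) := by
    rw [smul_smul, smul_smul]
    rfl
  have hrot : ∀ x : 𝔻, ((rotationZero t • x : 𝔻) : ℂ) = Complex.exp (t * Complex.I) * x := by
    intro x
    rw [← coe_rotation_zero, rotation, translation_zero]
    simp
  have hw : (translation v).w = 1 := by simp [Cover.w, translation]
  have hz : (translation v).z = v := rfl
  rw [h, coe_smul, hw, hz, hrot, coe_inv_translation_smul]
  push_cast
  rw [← Complex.conj_mul']
  simp only [Complex.UnitDisc.coe_zero, map_one]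
  congr 1 <;> ring

theorem norm_one_sub_mul_exp_sq (V σ : ℝ) :
    ‖1 - (V : ℂ) * Complex.exp ((2 * σ : ℝ) * Complex.I)‖ ^ 2 =
      (1 - V) ^ 2 + 4 * V * Real.sin σ ^ 2 := by
  rw [← Complex.normSq_eq_norm_sq, Complex.normSq_apply]
  simp only [Complex.sub_re, Complex.sub_im, Complex.re_ofReal_mul, Complex.im_ofReal_mul,
    Complex.exp_ofReal_mul_I_re, Complex.exp_ofReal_mul_I_im, Complex.one_re, Complex.one_im]
  rw [Real.sin_two_mul, Real.cos_two_mul]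
  linear_combination (4 * V ^ 2 * Real.cos σ ^ 2 - 4 * V) * Real.sin_sq_add_cos_sq σ

theorem one_sub_norm_rotation_sq (v : 𝔻) (σ : ℝ) :
    1 - ‖((rotation v (2 * σ) 0 : 𝔻) : ℂ)‖ ^ 2 = (1 - ‖(v : ℂ)‖ ^ 2) ^ 2 /
      ((1 - ‖(v : ℂ)‖ ^ 2) ^ 2 + 4 * ‖(v : ℂ)‖ ^ 2 * Real.sin σ ^ 2) := by
  have hv : 0 < 1 - ‖(v : ℂ)‖ ^ 2 := by linarith [v.sq_norm_lt_one]
  have h1 := norm_one_sub_mul_exp_sq 1 σ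
  rw [coe_rotation_apply_zero, norm_div, norm_mul, div_pow, mul_pow, norm_one_sub_mul_exp_sq]
  rw [Complex.ofReal_one, one_mul] at h1
  rw [h1]
  field_simp
  ring

/-- For the image `x` of the origin under a rotation about `v`, this writes the quantity
`|1 - conj x y|²`, whose level sets are Euclidean circles about `1 / conj x`, in terms of the
coordinates of `conj v * y`. -/
theorem norm_one_sub_conj_rotation_mul_sq (v : 𝔻) (σ : ℝ) (y : ℂ) :
    ‖1 - conj ((rotation v (2 * σ) 0 : 𝔻) : ℂ) * y‖ ^ 2 =
      (((1 - ‖(v : ℂ)‖ ^ 2) * Real.cos σ + 2 * Real.sin σ * (conj (v : ℂ) * y).im) ^ 2 +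
        Real.sin σ ^ 2 * (1 + ‖(v : ℂ)‖ ^ 2 - 2 * (conj (v : ℂ) * y).re) ^ 2) /
      ((1 - ‖(v : ℂ)‖ ^ 2) ^ 2 + 4 * ‖(v : ℂ)‖ ^ 2 * Real.sin σ ^ 2) := by
  have hv : 0 < 1 - ‖(v : ℂ)‖ ^ 2 := by linarith [v.sq_norm_lt_one]
  have hd : 1 - (‖(v : ℂ)‖ ^ 2 : ℝ) * Complex.exp ((2 * σ : ℝ) * Complex.I) ≠ 0 := by
    intro h
    have h1 := norm_one_sub_mul_exp_sq (‖(v : ℂ)‖ ^ 2) σ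
    rw [h, norm_zero] at h1
    have : 0 < (1 - ‖(v : ℂ)‖ ^ 2) ^ 2 + 4 * ‖(v : ℂ)‖ ^ 2 * Real.sin σ ^ 2 := by positivity
    linarith
  have hd' := (map_ne_zero (starRingEnd ℂ)).2 hd
  have key : 1 - conj ((rotation v (2 * σ) 0 : 𝔻) : ℂ) * y =
      (conj (1 - (‖(v : ℂ)‖ ^ 2 : ℝ) * Complex.exp ((2 * σ : ℝ) * Complex.I)) -
        conj (1 - Complex.exp ((2 * σ : ℝ) * Complex.I)) * (conj (v : ℂ) * y)) /
        conj (1 - (‖(v : ℂ)‖ ^ 2 : ℝ) * Complex.exp ((2 * σ : ℝ) * Complex.I)) := by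
    rw [coe_rotation_apply_zero, map_div₀, map_mul, sub_div, div_self hd']
    ring
  rw [key, norm_div, div_pow, Complex.norm_conj, norm_one_sub_mul_exp_sq]
  congr 1
  generalize conj (v : ℂ) * y = a
  generalize ‖(v : ℂ)‖ ^ 2 = V
  rw [← Complex.normSq_eq_norm_sq, Complex.normSq_apply]
  simp only [Complex.sub_re, Complex.sub_im, Complex.mul_re, Complex.mul_im, Complex.conj_re,
    Complex.conj_im, Complex.ofReal_re, Complex.ofReal_im,
    Complex.exp_ofReal_mul_I_re, Complex.exp_ofReal_mul_I_im, Complex.one_re, Complex.one_im]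
  rw [Real.sin_two_mul, Real.cos_two_mul']
  have h := Real.sin_sq_add_cos_sq σ
  have hc : Real.cos σ ^ 2 = 1 - Real.sin σ ^ 2 := by linarith
  ring_nf
  have hc4 : Real.cos σ ^ 4 = (1 - Real.sin σ ^ 2) ^ 2 := by rw [← hc]; ring
  simp only [hc4, hc]
  ring

/-- This bound identifies members of the edge corona without any knowledge of the Dirichlet regions:
the points of the orbit at a Euclidean distance less than `R ≥ tanh L₀` belong to it by assumption.
-/
theorem norm_rotation_lt_tanh {v : 𝔻} (hv : v ≠ 0) {σ : ℝ} (hσ : Real.cos σ ≠ 0) :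
    ‖((rotation v (2 * σ) 0 : 𝔻) : ℂ)‖ < Real.tanh (hypDist 0 v) := by
  have hv0 : 0 < ‖(v : ℂ)‖ := norm_pos_iff.2 (by simpa using hv)
  have hv1 : 0 < 1 - ‖(v : ℂ)‖ ^ 2 := by linarith [v.sq_norm_lt_one]
  have htanh : Real.tanh (hypDist 0 v) = 2 * ‖(v : ℂ)‖ / (1 + ‖(v : ℂ)‖ ^ 2) := by
    rw [Real.tanh_eq_sinh_div_cosh, sinh_hypDist, cosh_hypDist]
    field_simp
  rw [htanh]
  refine lt_of_pow_lt_pow_left₀ 2 (by positivity) ?_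
  have h := one_sub_norm_rotation_sq v σ
  have h1 : 1 - (2 * ‖(v : ℂ)‖ / (1 + ‖(v : ℂ)‖ ^ 2)) ^ 2 =
      (1 - ‖(v : ℂ)‖ ^ 2) ^ 2 / (1 + ‖(v : ℂ)‖ ^ 2) ^ 2 := by
    field_simp
    ring
  have h2 : (1 - ‖(v : ℂ)‖ ^ 2) ^ 2 / (1 + ‖(v : ℂ)‖ ^ 2) ^ 2 < (1 - ‖(v : ℂ)‖ ^ 2) ^ 2 /
      ((1 - ‖(v : ℂ)‖ ^ 2) ^ 2 + 4 * ‖(v : ℂ)‖ ^ 2 * Real.sin σ ^ 2) := by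
    refine div_lt_div_of_pos_left (by positivity) (by positivity) ?_
    have hc : 0 < Real.cos σ ^ 2 := by positivity
    have := Real.sin_sq_add_cos_sq σ
    nlinarith [mul_pos (pow_pos hv0 2) hc]
  linarith

theorem rotation_apply_zero_ne_zero {v : 𝔻} (hv : v ≠ 0) {σ : ℝ} (hσ : Real.sin σ ≠ 0) :
    rotation v (2 * σ) 0 ≠ 0 := by
  intro h
  have hv0 : 0 < ‖(v : ℂ)‖ := norm_pos_iff.2 (by simpa using hv)
  have hv1 : 0 < 1 - ‖(v : ℂ)‖ ^ 2 := by linarith [v.sq_norm_lt_one]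
  have h1 := one_sub_norm_rotation_sq v σ
  have h2 : 0 < 4 * ‖(v : ℂ)‖ ^ 2 * Real.sin σ ^ 2 := by positivity
  rw [h, Complex.UnitDisc.coe_zero, norm_zero, eq_div_iff (by positivity)] at h1
  linarith

/-! ### The regions left uncovered by the edge corona -/

/-- The ratio of `1 - cos ψ` to `sin ψ` is `tan (ψ/2)`, which increases with `ψ`. -/
theorem half_angle_le {C c s A ψ : ℝ} (hC : 0 ≤ C) (hc : 0 ≤ c) (hs : 0 ≤ s) (hψ : 0 ≤ ψ)
    (hψA : ψ ≤ A) (hA : A ≤ Real.pi) (h : C * s * Real.sin (A / 2) ≤ c * Real.cos (A / 2)) :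
    C * s * (1 - Real.cos ψ) ≤ c * Real.sin ψ := by
  have hpi := Real.pi_pos
  have h1 : Real.sin (ψ / 2) ≤ Real.sin (A / 2) :=
    Real.sin_le_sin_of_le_of_le_pi_div_two (by linarith) (by linarith) (by linarith)
  have h2 : Real.cos (A / 2) ≤ Real.cos (ψ / 2) :=
    Real.cos_le_cos_of_nonneg_of_le_pi (by linarith) (by linarith) (by linarith)
  have h3 : 0 ≤ Real.sin (ψ / 2) := Real.sin_nonneg_of_nonneg_of_le_pi (by linarith) (by linarith)
  have h4 : C * s * Real.sin (ψ / 2) ≤ c * Real.cos (ψ / 2) :=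
    (mul_le_mul_of_nonneg_left h1 (mul_nonneg hC hs)).trans
      (h.trans (mul_le_mul_of_nonneg_left h2 hc))
  have h5 := Real.sin_two_mul (ψ / 2)
  have h6 := Real.cos_two_mul (ψ / 2)
  have h7 := Real.sin_sq_add_cos_sq (ψ / 2)
  rw [mul_div_cancel₀ _ (two_ne_zero : (2 : ℝ) ≠ 0)] at h5 h6
  have h8 : 1 - Real.cos ψ = 2 * Real.sin (ψ / 2) ^ 2 := by linarith
  rw [h8, h5]
  nlinarith [mul_le_mul_of_nonneg_left h4 h3]

theorem ellMinus_mono {L : ℝ} (hL : 0 < L) {q : ℕ} (hs : 0 < Real.sin (Real.pi / q)) {t t₀ : ℝ}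
    (ht : 0 < t) (htt : t ≤ t₀) : ellMinus L q t ≤ ellMinus L q t₀ := by
  have hS := Real.sinh_pos_iff.2 hL
  unfold ellMinus
  gcongr

/-- The disc belonging to the image of the origin under the rotation about `v` through `2σ = ±2π/q`.
The ray through `v` enters it at the distance `ellMinus`, and the rays on the appropriate side of
that ray, at an angle of at most `A`, enter it earlier. Here `r` and `ψ` are the polar coordinates
of a point with respect to the ray through `v`. -/
theorem disc_equation_le {v : 𝔻} (hv : v ≠ 0) {q : ℕ} {A t r ψ σ : ℝ}
    (hs : 0 < Real.sin (Real.pi / q)) (hc : 0 ≤ Real.cos (Real.pi / q))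
    (hA : Real.cosh (hypDist 0 v) * Real.sin (Real.pi / q) * Real.sin (A / 2) ≤
      Real.cos (Real.pi / q) * Real.cos (A / 2))
    (hApi : A ≤ Real.pi) (hψ : |ψ| ≤ A) (hW : Real.cos (Real.pi / q) ^ 2 ≤ 1 / t ^ 2)
    (hr0 : 0 ≤ r) (hr1 : r < 1) (hr : ellMinus (hypDist 0 v) q t ≤ r)
    (hcσ : Real.cos σ = Real.cos (Real.pi / q))
    (hsσ : Real.sin σ ^ 2 = Real.sin (Real.pi / q) ^ 2)
    (hsgn : Real.sin σ * Real.sin ψ = -(Real.sin (Real.pi / q) * Real.sin |ψ|)) :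
    ((1 - ‖(v : ℂ)‖ ^ 2) * Real.cos σ + 2 * Real.sin σ * (‖(v : ℂ)‖ * r * Real.sin ψ)) ^ 2 +
      Real.sin σ ^ 2 * (1 + ‖(v : ℂ)‖ ^ 2 - 2 * (‖(v : ℂ)‖ * r * Real.cos ψ)) ^ 2 ≤
      (1 - ‖(v : ℂ)‖ ^ 2) ^ 2 / t ^ 2 := by
  have hv1 : 0 < 1 - ‖(v : ℂ)‖ ^ 2 := by linarith [v.sq_norm_lt_one]
  have hv0 : 0 < ‖(v : ℂ)‖ := norm_pos_iff.2 (by simpa using hv)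
  have hvlt := v.norm_lt_one
  have hhalf := half_angle_le (Real.cosh_pos _).le hc hs.le (abs_nonneg ψ) hψ hApi hA
  rw [Real.cos_abs, cosh_hypDist] at hhalf
  rw [ellMinus, Real.tanh_eq_sinh_div_cosh, sinh_hypDist, cosh_hypDist] at hr
  rw [hcσ, hsσ]
  have e1 : 2 * Real.sin σ * (‖(v : ℂ)‖ * r * Real.sin ψ) =
      -(2 * ‖(v : ℂ)‖ * r * (Real.sin (Real.pi / q) * Real.sin |ψ|)) := by
    linear_combination 2 * ‖(v : ℂ)‖ * r * hsgn
  have e2 : (Real.sin σ * Real.sin ψ) ^ 2 = Real.sin (Real.pi / q) ^ 2 * Real.sin ψ ^ 2 := by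
    rw [mul_pow, hsσ]
  rw [hsgn] at e2
  have hW0 := Real.sq_sqrt (sub_nonneg.2 hW)
  set W := √(1 / t ^ 2 - Real.cos (Real.pi / q) ^ 2)
  have hWn : 0 ≤ W := Real.sqrt_nonneg _
  rw [e1]
  set s := Real.sin (Real.pi / q)
  set c := Real.cos (Real.pi / q)
  set m := ‖(v : ℂ)‖
  set y := Real.sin |ψ|
  set x := Real.cos ψ
  have hxy : x ^ 2 + Real.sin ψ ^ 2 = 1 := Real.cos_sq_add_sin_sq ψ
  -- The case `ψ = 0`; the absolute value of the left-hand side of `h1` can be dropped because the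
  -- ray leaves the disc at a distance of more than `1`.
  have h1 : s * (1 + m ^ 2 - 2 * m * r) ≤ (1 - m ^ 2) * W := by
    have h2 : 1 / (2 * m / (1 - m ^ 2) / ((1 + m ^ 2) / (1 - m ^ 2))) -
        1 / (2 * m / (1 - m ^ 2) * s) * W =
        ((1 + m ^ 2) * s - (1 - m ^ 2) * W) / (2 * m * s) := by
      field_simp
    rw [h2, div_le_iff₀ (by positivity)] at hr
    linarith
  have h3 : 0 ≤ s * (1 + m ^ 2 - 2 * m * r) := by
    refine mul_nonneg hs.le ?_
    nlinarith [sq_nonneg (1 - m)]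
  have h4 : (s * (1 + m ^ 2 - 2 * m * r)) ^ 2 ≤ (1 - m ^ 2) ^ 2 * (1 / t ^ 2 - c ^ 2) := by
    rw [← hW0, ← mul_pow]
    exact pow_le_pow_left₀ h3 h1 2
  -- Turning the ray from `ψ = 0` to `ψ` decreases the left-hand side of the equation.
  have h5 : (1 + m ^ 2) * s * (1 - x) ≤ (1 - m ^ 2) * (c * y) := by
    have h6 : (1 + m ^ 2) / (1 - m ^ 2) * s * (1 - x) =
        (1 + m ^ 2) * s * (1 - x) / (1 - m ^ 2) := by
      ring
    rw [h6, div_le_iff₀ hv1] at hhalf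
    linarith
  have h6 : 0 ≤ 4 * s * (m * r) := by positivity
  have h7 := mul_le_mul_of_nonneg_left h5 h6
  have h8 : (1 - m ^ 2) ^ 2 / t ^ 2 = (1 - m ^ 2) ^ 2 * (1 / t ^ 2 - c ^ 2) +
      (1 - m ^ 2) ^ 2 * c ^ 2 := by ring
  rw [h8]
  have e3 : (2 * m * r * (s * y)) ^ 2 = 4 * m ^ 2 * r ^ 2 * s ^ 2 * (1 - x ^ 2) := by
    have e4 : Real.sin ψ ^ 2 = 1 - x ^ 2 := by linarith
    rw [e4] at e2
    linear_combination 4 * m ^ 2 * r ^ 2 * e2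
  linarith [h4, h7, e3, show ((1 - m ^ 2) * c + -(2 * m * r * (s * y))) ^ 2 +
    s ^ 2 * (1 + m ^ 2 - 2 * (m * r * x)) ^ 2 = (1 - m ^ 2) ^ 2 * c ^ 2 +
    (s * (1 + m ^ 2 - 2 * m * r)) ^ 2 +
    (4 * s * (m * r) * ((1 + m ^ 2) * s * (1 - x)) -
      4 * s * (m * r) * ((1 - m ^ 2) * (c * y))) + ((2 * m * r * (s * y)) ^ 2 -
      4 * m ^ 2 * r ^ 2 * s ^ 2 * (1 - x ^ 2)) by ring]

theorem exists_int_abs_sub_le {d : ℝ} (hd : 0 < d) (φ : ℝ) : ∃ j : ℤ, |φ - j * d| ≤ d / 2 := by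
  refine ⟨round (φ / d), ?_⟩
  have h1 : φ - round (φ / d) * d = (φ / d - round (φ / d)) * d := by
    rw [sub_mul, div_mul_cancel₀ _ hd.ne']
  rw [h1, abs_mul, abs_of_pos hd]
  linarith [mul_le_mul_of_nonneg_right (abs_sub_round (φ / d)) hd.le]

/-- Every ray from the origin lies within an angle `π/p` of the ray through an image of `v` under a
rotation about the origin. By `disc_equation_le` it enters a disc, belonging to an image of the
origin under a rotation about that image of `v`, at a distance of at most `ellMinus`, and it does
not leave the disc within the hyperbolic plane. -/
theorem exists_rotation_covering {v : 𝔻} (hv : v ≠ 0) {p q : ℕ} {t : ℝ} (hp : 0 < p) (ht : 0 < t)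
    (hs : 0 < Real.sin (Real.pi / q)) (hc : 0 ≤ Real.cos (Real.pi / q))
    (hA : Real.cosh (hypDist 0 v) * Real.sin (Real.pi / q) * Real.sin (Real.pi / p / 2) ≤
      Real.cos (Real.pi / q) * Real.cos (Real.pi / p / 2))
    (hW : Real.cos (Real.pi / q) ^ 2 ≤ 1 / t ^ 2)
    {y : ℂ} (hy1 : ‖y‖ < 1) (hy : ellMinus (hypDist 0 v) q t ≤ ‖y‖) :
    ∃ (j n : ℤ), (n = 1 ∨ n = -1) ∧
      t * ‖1 - conj ((rotation 0 (j * (2 * Real.pi / p)) (rotation v (n * (2 * Real.pi / q)) 0) :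
        𝔻) : ℂ) * y‖ ≤ √(1 - ‖((rotation 0 (j * (2 * Real.pi / p))
          (rotation v (n * (2 * Real.pi / q)) 0) : 𝔻) : ℂ)‖ ^ 2) := by
  have hpi := Real.pi_pos
  have hp' : (0 : ℝ) < p := by exact_mod_cast hp
  obtain ⟨j, hj⟩ := exists_int_abs_sub_le (d := 2 * Real.pi / p) (by positivity)
    (Complex.arg (conj (v : ℂ) * y))
  rw [div_right_comm, mul_div_cancel_left₀ _ (two_ne_zero : (2 : ℝ) ≠ 0)] at hj
  set α : ℝ := j * (2 * Real.pi / p) with hα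
  set ψ : ℝ := Complex.arg (conj (v : ℂ) * y) - α with hψ
  have hApi : Real.pi / p ≤ Real.pi :=
    div_le_self hpi.le (by exact_mod_cast hp)
  have hsψ : 0 ≤ Real.sin |ψ| :=
    Real.sin_nonneg_of_nonneg_of_le_pi (abs_nonneg _) (hj.trans hApi)
  -- the point `y` turned back by the angle `α`
  set y' : ℂ := Complex.exp (-α * Complex.I) * y with hy'
  have hvy : conj (v : ℂ) * y' = (‖(v : ℂ)‖ * ‖y‖ : ℝ) * Complex.exp (ψ * Complex.I) := by
    have h := Complex.norm_mul_exp_arg_mul_I (conj (v : ℂ) * y)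
    rw [norm_mul, Complex.norm_conj] at h
    have h2 : Complex.exp (ψ * Complex.I) =
        Complex.exp (-α * Complex.I) *
          Complex.exp (Complex.arg (conj (v : ℂ) * y) * Complex.I) := by
      rw [← Complex.exp_add, hψ]
      congr 1
      push_cast
      ring
    rw [h2, hy']
    linear_combination -Complex.exp (-α * Complex.I) * h
  have hre : (conj (v : ℂ) * y').re = ‖(v : ℂ)‖ * ‖y‖ * Real.cos ψ := by
    rw [hvy, Complex.re_ofReal_mul, Complex.exp_ofReal_mul_I_re]
  have him : (conj (v : ℂ) * y').im = ‖(v : ℂ)‖ * ‖y‖ * Real.sin ψ := by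
    rw [hvy, Complex.im_ofReal_mul, Complex.exp_ofReal_mul_I_im]
  have hmain : ∀ n : ℤ, (n = 1 ∨ n = -1) →
      Real.sin (n * (Real.pi / q)) * Real.sin ψ = -(Real.sin (Real.pi / q) * Real.sin |ψ|) →
      t * ‖1 - conj ((rotation 0 α (rotation v (n * (2 * Real.pi / q)) 0) : 𝔻) : ℂ) * y‖ ≤
        √(1 - ‖((rotation 0 α (rotation v (n * (2 * Real.pi / q)) 0) : 𝔻) : ℂ)‖ ^ 2) := by
    intro n hn hsgn
    have hτ : (n : ℝ) * (2 * Real.pi / q) = 2 * (n * (Real.pi / q)) := by ring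
    have hcn : Real.cos (n * (Real.pi / q)) = Real.cos (Real.pi / q) := by
      rcases hn with rfl | rfl <;> simp
    have hsn : Real.sin (n * (Real.pi / q)) ^ 2 = Real.sin (Real.pi / q) ^ 2 := by
      rcases hn with rfl | rfl <;> simp
    rw [hτ]
    set σ : ℝ := n * (Real.pi / q)
    have hx : ((rotation 0 α (rotation v (2 * σ) 0) : 𝔻) : ℂ) =
        Complex.exp (α * Complex.I) * ((rotation v (2 * σ) 0 : 𝔻) : ℂ) := coe_rotation_zero _ _
    have hxn : ‖((rotation 0 α (rotation v (2 * σ) 0) : 𝔻) : ℂ)‖ =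
        ‖((rotation v (2 * σ) 0 : 𝔻) : ℂ)‖ := by
      rw [hx, norm_mul, Complex.norm_exp_ofReal_mul_I, one_mul]
    have hxy : conj ((rotation 0 α (rotation v (2 * σ) 0) : 𝔻) : ℂ) * y =
        conj ((rotation v (2 * σ) 0 : 𝔻) : ℂ) * y' := by
      rw [hx, map_mul, ← Complex.exp_conj, map_mul, Complex.conj_ofReal, Complex.conj_I, hy']
      ring_nf
    rw [hxn, hxy]
    refine Real.le_sqrt_of_sq_le ?_
    rw [mul_pow, norm_one_sub_conj_rotation_mul_sq, one_sub_norm_rotation_sq, hre, him]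
    have hv1 : 0 < 1 - ‖(v : ℂ)‖ ^ 2 := by linarith [v.sq_norm_lt_one]
    rw [← mul_div_assoc]
    refine div_le_div_of_nonneg_right ?_ (by positivity)
    have := disc_equation_le hv hs hc hA hApi hj hW (norm_nonneg y) hy1 hy hcn hsn hsgn
    rw [le_div_iff₀ (by positivity)] at this
    linarith
  rcases le_total 0 ψ with h0 | h0
  · refine ⟨j, -1, Or.inr rfl, hmain (-1) (Or.inr rfl) ?_⟩
    rw [abs_of_nonneg h0]
    simp
  · refine ⟨j, 1, Or.inl rfl, hmain 1 (Or.inl rfl) ?_⟩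
    rw [abs_of_nonpos h0]
    simp

theorem mul_one_sub_ellMinus (L : ℝ) (q : ℕ) {t : ℝ} (ht : 0 < t) (R : ℝ) :
    t * (1 - R * ellMinus L q t) = t * (1 - R / Real.tanh L) +
      R / (Real.sinh L * Real.sin (Real.pi / q)) * √(1 - t ^ 2 * Real.cos (Real.pi / q) ^ 2) := by
  have h : √(1 - t ^ 2 * Real.cos (Real.pi / q) ^ 2) =
      t * √(1 / t ^ 2 - Real.cos (Real.pi / q) ^ 2) := by
    rw [← Real.sqrt_sq ht.le, ← Real.sqrt_mul (sq_nonneg t), Real.sqrt_sq ht.le]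
    congr 1
    field_simp
  rw [h, ellMinus]
  ring

/-- A point of the region left uncovered by the edge corona is not covered by the prisms over the
points at a distance of at least `R`. By the choice of `R` this is so at the height `t₀`; it is so
at a lower height `t` because `t (1 - R * ellMinus t)` decreases with `t` if `tanh L ≤ R`. -/
theorem lt_mul_one_sub_of_lt_ellMinus {L : ℝ} (hL : 0 < L) {q : ℕ}
    (hs : 0 < Real.sin (Real.pi / q)) {R X r t t₀ : ℝ} (ht : 0 < t) (htt : t ≤ t₀)
    (hR : Real.tanh L ≤ R) (hell : ellMinus L q t₀ ≤ (1 - √(1 - R ^ 2)) / R)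
    (hr : r < ellMinus L q t) (hRX : R ≤ X) (hX : X < 1) (hr0 : 0 ≤ r) :
    t₀ * √(1 - X ^ 2) < t * (1 - X * r) := by
  have htanh : 0 < Real.tanh L := by
    rw [Real.tanh_eq_sinh_div_cosh]
    exact div_pos (Real.sinh_pos_iff.2 hL) (Real.cosh_pos L)
  have hR0 : 0 < R := htanh.trans_le hR
  have hR1 : R < 1 := hRX.trans_lt hX
  have hS := Real.sinh_pos_iff.2 hL
  have hRsq : 0 < 1 - R ^ 2 := by nlinarith
  have hXsq : 0 < 1 - X ^ 2 := by nlinarith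
  set a := √(1 - R ^ 2) with ha
  set b := √(1 - X ^ 2) with hb
  have ha2 : a ^ 2 = 1 - R ^ 2 := Real.sq_sqrt hRsq.le
  have hb2 : b ^ 2 = 1 - X ^ 2 := Real.sq_sqrt hXsq.le
  have ha0 : 0 < a := Real.sqrt_pos.2 hRsq
  have hb0 : 0 < b := Real.sqrt_pos.2 hXsq
  have hrR : r ≤ R := by
    have h1 : r ≤ (1 - a) / R := hr.le.trans ((ellMinus_mono hL hs ht htt).trans hell)
    rw [le_div_iff₀ hR0] at h1
    have ha1 : a ≤ 1 := by nlinarith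
    by_contra! h
    nlinarith
  have hmono : t₀ * (1 - R * ellMinus L q t₀) ≤ t * (1 - R * ellMinus L q t) := by
    rw [mul_one_sub_ellMinus L q ht, mul_one_sub_ellMinus L q (ht.trans_le htt)]
    have h1 : 1 - R / Real.tanh L ≤ 0 := by
      rw [sub_nonpos, le_div_iff₀ htanh]
      linarith
    have h2 : R / (Real.sinh L * Real.sin (Real.pi / q)) *
        √(1 - t₀ ^ 2 * Real.cos (Real.pi / q) ^ 2) ≤
        R / (Real.sinh L * Real.sin (Real.pi / q)) *
          √(1 - t ^ 2 * Real.cos (Real.pi / q) ^ 2) := by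
      gcongr
    nlinarith
  have hlow : t₀ * a ≤ t₀ * (1 - R * ellMinus L q t₀) := by
    have h1 := (le_div_iff₀ hR0).1 hell
    refine mul_le_mul_of_nonneg_left ?_ (ht.trans_le htt).le
    linarith
  have hRr : t₀ * a < t * (1 - R * r) := by
    refine (hlow.trans hmono).trans_lt (mul_lt_mul_of_pos_left ?_ ht)
    nlinarith
  -- `(1 - X r) / √(1 - X²)` increases with `X` for `X ≥ r`
  have hXr : 0 < 1 - X * r := by nlinarith
  have hinc : (1 - R * r) * b ≤ (1 - X * r) * a := by
    refine le_of_sq_le_sq ?_ (by positivity)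
    rw [mul_pow, mul_pow, ha2, hb2]
    have h1 : (1 - X * r) ^ 2 * (1 - R ^ 2) - (1 - R * r) ^ 2 * (1 - X ^ 2) =
        (X - R) * ((X - r) * (1 - r * R) + (R - r) * (1 - r * X)) := by ring
    have h2 : 0 ≤ (X - R) * ((X - r) * (1 - r * R) + (R - r) * (1 - r * X)) := by
      have h3 : 0 ≤ 1 - r * R := by nlinarith
      refine mul_nonneg (sub_nonneg.2 hRX) (add_nonneg (mul_nonneg ?_ h3) (mul_nonneg ?_ ?_)) <;>
        linarith
    linarith
  refine lt_of_mul_lt_mul_right ?_ ha0.le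
  calc t₀ * b * a = t₀ * a * b := by ring
    _ < t * (1 - R * r) * b := mul_lt_mul_of_pos_right hRr hb0
    _ = t * ((1 - R * r) * b) := by ring
    _ ≤ t * ((1 - X * r) * a) := mul_le_mul_of_nonneg_left hinc ht.le
    _ = t * (1 - X * r) * a := by ring

/-! ### The prisms -/

theorem norm_inv_mul_w {h : Cover} (hn : h.nrm = 1) (a : Cover) :
    ‖(h⁻¹ * a).w‖ * √(1 - ‖((h • (0 : 𝔻) : 𝔻) : ℂ)‖ ^ 2) =
      ‖a.w‖ * ‖1 - conj ((h • (0 : 𝔻) : 𝔻) : ℂ) * (a.z / a.w)‖ := by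
  have hw := h.w_ne_zero
  have hw' := h.norm_w_pos
  have ha := a.w_ne_zero
  have hc : conj h.w ≠ 0 := (map_ne_zero _).2 hw
  have h1 : (h⁻¹ * a).w = conj h.w * (a.w * (1 - conj (h.z / h.w) * (a.z / a.w))) := by
    rw [inv_mul_w hn, map_div₀]
    field_simp
  have h2 : √(1 - ‖h.z / h.w‖ ^ 2) = 1 / ‖h.w‖ := by
    have h3 : 1 - ‖h.z / h.w‖ ^ 2 = (1 / ‖h.w‖) ^ 2 := by
      have h4 : ‖h.w‖ ^ 2 - ‖h.z‖ ^ 2 = 1 := hn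
      rw [norm_div]
      field_simp
      exact h4
    rw [h3, Real.sqrt_sq (by positivity)]
  rw [smul_zero_eq, h1, h2, norm_mul, norm_mul, Complex.norm_conj]
  field_simp

/-- If `h` maps the origin to `x`, the assumption means that `|w|` is at most `1` at the translate
`h⁻¹ a`, so that `Re w ≤ 1` there for every such `h`. -/
theorem mem_prism {Γ₁ Γ₂ : Subgroup G} (hfix : ∀ g ∈ Γ₂, g • (0 : 𝔻) = 0) {x : 𝔻} {a : Cover}
    (h : ‖a.w‖ * ‖1 - conj (x : ℂ) * (a.z / a.w)‖ ≤ √(1 - ‖(x : ℂ)‖ ^ 2)) :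
    a ∈ prism Γ₁ Γ₂ 0 x := by
  unfold prism
  simp only [Set.mem_iInter]
  rintro g₁ ⟨-, hg₁⟩ g₂ hg₂
  have hn : ((g₁ * g₂ : G) : Cover).nrm = 1 := (g₁ * g₂).2
  have hx : ((g₁ * g₂ : G) : Cover) • (0 : 𝔻) = x := by
    change (g₁ * g₂) • (0 : 𝔻) = x
    rw [mul_smul, hfix g₂ hg₂, hg₁]
  refine mem_halfSpaceH hn ((Complex.re_le_norm _).trans ?_)
  have h1 := norm_inv_mul_w hn a
  rw [hx] at h1
  have h2 : 0 < √(1 - ‖(x : ℂ)‖ ^ 2) := Real.sqrt_pos.2 (by linarith [x.sq_norm_lt_one])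
  refine le_of_mul_le_mul_right ?_ h2
  rw [h1, one_mul]
  exact h

/-- If `Γ₁` and `Γ₂` together contain the elements of the one-parameter group `rot` at all multiples
of `2θ`, then `|w| ≤ sec θ` on the translate to the origin of the prism over `g • 0`: some
multiple of `2θ` differs from the argument by at most `θ`. -/
theorem norm_le_sec_of_mem_prism {Γ₁ Γ₂ : Subgroup G} {θ : ℝ} (hθ0 : 0 < θ)
    (hθ : θ < Real.pi / 2)
    (hrot : ∀ n : ℤ, ∃ s t : ℝ, rot s ∈ Γ₁ ∧ rot t ∈ Γ₂ ∧ s + t = n * (2 * θ))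
    {g : G} (hg : g ∈ Γ₁) {a : Cover} (ha : a ∈ prism Γ₁ Γ₂ 0 (g • (0 : 𝔻))) :
    ‖((g : Cover)⁻¹ * a).w‖ ≤ sec θ := by
  set b : Cover := (g : Cover)⁻¹ * a with hb
  obtain ⟨n, hn⟩ := exists_int_abs_sub_le (d := 2 * θ) (by linarith) b.ω.im
  rw [mul_div_cancel_left₀ _ (two_ne_zero : (2 : ℝ) ≠ 0)] at hn
  obtain ⟨s, t, hs, ht, hst⟩ := hrot n
  unfold prism at ha
  simp only [Set.mem_iInter] at ha
  have hmem := ha (g * rot s) ⟨Γ₁.mul_mem hg hs, by rw [mul_smul, rot_smul_zero]⟩ (rot t) ht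
  have hinv : ((g * rot s * rot t : G) : Cover)⁻¹ * a = (rot (-(s + t)) : Cover) * b := by
    rw [mul_assoc, ← rot_add, rot_neg, hb]
    push_cast
    group
  have hω : ((rot (-(s + t)) : Cover) * b).ω = b.ω - ((n * (2 * θ) : ℝ) : ℂ) * Complex.I := by
    rw [Cover.mul_ω, rot_ω, hst]
    simp [Cover.quot, rot_z]
    ring
  have him : ((rot (-(s + t)) : Cover) * b).ω.im = b.ω.im - n * (2 * θ) := by
    rw [hω, Complex.sub_im, Complex.im_ofReal_mul, Complex.I_im, mul_one]
  have hre : ((rot (-(s + t)) : Cover) * b).ω.re = b.ω.re := by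
    rw [hω, Complex.sub_re, Complex.re_ofReal_mul, Complex.I_re, mul_zero, sub_zero]
  have hcos : 0 < Real.cos θ := Real.cos_pos_of_mem_Ioo ⟨by linarith, hθ⟩
  by_contra! hlt
  refine notMem_halfSpaceH (g * rot s * rot t).2 ?_ ?_ hmem
  · rw [hinv, him]
    exact hn.trans_lt hθ
  · rw [hinv, Cover.w, Complex.exp_re, him, hre]
    have h1 : ‖b.w‖ = Real.exp b.ω.re := Complex.norm_exp _
    have h2 : Real.cos θ ≤ Real.cos (b.ω.im - n * (2 * θ)) := by
      rw [← Real.cos_abs (b.ω.im - n * (2 * θ))]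
      exact Real.cos_le_cos_of_nonneg_of_le_pi (abs_nonneg _) (by linarith) hn
    rw [h1, sec, div_lt_iff₀ hcos] at hlt
    exact hlt.trans_le (mul_le_mul_of_nonneg_left h2 (Real.exp_pos _).le)

theorem isClosed_prism (Γ₁ Γ₂ : Subgroup G) (u x : 𝔻) : IsClosed (prism Γ₁ Γ₂ u x) :=
  isClosed_biInter fun _ _ => isClosed_biInter fun _ _ => isClosed_halfSpaceH _

theorem smul_zero_of_image_eq {Γ : Subgroup G} {t : ℝ}
    (h : image Γ = Subgroup.zpowers (rotation 0 t)) {g : G} (hg : g ∈ Γ) : g • (0 : 𝔻) = 0 := by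
  have h1 : MulAction.toPermHom G 𝔻 g ∈ image Γ := Subgroup.mem_map_of_mem _ hg
  rw [h] at h1
  obtain ⟨n, hn⟩ := h1
  have h2 : g • (0 : 𝔻) = (rotation 0 t ^ n) 0 := by
    rw [show rotation 0 t ^ n = _ from hn]
    rfl
  rw [h2, rotation_zpow]
  apply Complex.UnitDisc.coe_injective
  rw [coe_rotation_zero]
  simp

theorem mem_orbit_of_mem_image {Γ : Subgroup G} {f : Equiv.Perm 𝔻} (hf : f ∈ image Γ) (x : 𝔻) :
    f x ∈ MulAction.orbit Γ x := by
  obtain ⟨g, hg, rfl⟩ := hf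
  exact ⟨⟨g, hg⟩, rfl⟩

end LorentzBiquotient

end

open LorentzBiquotient in
theorem theorem3 (p₁ p₂ q r k : ℕ)
    (hp₁ : 2 ≤ p₁) (hp₂ : 1 ≤ p₂) (hr : 2 ≤ r) (hrq : r ≤ q)
    (v w : Complex.UnitDisc) (htri : IsTriangle 0 v w p₁ q r)
    (Γ₁ Γ₂ : Subgroup G)
    (hΓ₁ : HasLevel Γ₁ k) (himage₁ : image Γ₁ = triangleGroup 0 v w p₁ q r)
    (hΓ₂ : HasLevel Γ₂ k)
    (himage₂ : image Γ₂ = Subgroup.zpowers (rotation 0 (2 * Real.pi / p₂)))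
    (hp : k * q ≤ 2 * Nat.lcm p₁ p₂)
    (R : ℝ) (hR : Real.tanh (hypDist 0 v) ≤ R)
    (hcorona : {x ∈ MulAction.orbit Γ₁ (0 : Complex.UnitDisc) | ‖(x : ℂ)‖ < R} =
      edgeCorona (image Γ₁) 0 ∪ {0})
    (hell : ellMinus (hypDist 0 v) q (sec (Real.pi * k / (2 * Nat.lcm p₁ p₂))) ≤
      (1 - √(1 - R ^ 2)) / R) :
    fundInterior Γ₁ Γ₂ 0 = domainInterior Γ₁ Γ₂ 0 (edgeCorona (image Γ₁) 0) := by
  obtain ⟨h0v, hvw, hw0, hA, hB, hC⟩ := htri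
  have hv : v ≠ 0 := h0v.symm
  have hpi := Real.pi_pos
  have hlaw := dual_cosine_law hv hw0 hvw
  rw [hA, hB, hC] at hlaw
  have hq := three_le_of_dual_cosine_law hp₁ hr hrq hlaw
  have hhalf := cosh_mul_sin_mul_sin_half_le hp₁ hr hrq hlaw
  have hqR : (3 : ℝ) ≤ q := by exact_mod_cast hq
  have hkR : (0 : ℝ) < k := by exact_mod_cast hΓ₁.1
  have hlcm : (0 : ℝ) < Nat.lcm p₁ p₂ := by
    exact_mod_cast Nat.lcm_pos (by omega : 0 < p₁) (by omega : 0 < p₂)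
  have hq0 : 0 < Real.pi / q := by positivity
  have hq2 : Real.pi / q < Real.pi / 2 := by
    apply div_lt_div_of_pos_left hpi (by norm_num) (by linarith)
  have hs : 0 < Real.sin (Real.pi / q) := Real.sin_pos_of_pos_of_lt_pi hq0 (by linarith)
  have hc : 0 < Real.cos (Real.pi / q) := Real.cos_pos_of_mem_Ioo ⟨by linarith, hq2⟩
  have hL : 0 < hypDist 0 v := by
    rw [← Real.sinh_pos_iff, sinh_hypDist]
    have hv0 : 0 < ‖(v : ℂ)‖ := norm_pos_iff.2 (by simpa using hv)
    exact div_pos (by positivity) (by linarith [v.sq_norm_lt_one])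
  -- the half-angle `θ` of a side of the prisms
  set θ : ℝ := Real.pi * k / (2 * Nat.lcm p₁ p₂) with hθ
  have hθ0 : 0 < θ := by positivity
  have hθq : θ ≤ Real.pi / q := by
    have hpR : (k : ℝ) * q ≤ 2 * Nat.lcm p₁ p₂ := by exact_mod_cast hp
    rw [hθ, div_le_div_iff₀ (by positivity) (by positivity)]
    nlinarith
  have hcosθ : Real.cos (Real.pi / q) ≤ Real.cos θ :=
    Real.cos_le_cos_of_nonneg_of_le_pi hθ0.le (by linarith) hθq
  have hrot : ∀ n : ℤ, ∃ s t : ℝ, rot s ∈ Γ₁ ∧ rot t ∈ Γ₂ ∧ s + t = n * (2 * θ) := by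
    intro n
    have h1 : rot (k * Real.pi / p₁) ∈ Γ₁ := by
      refine hΓ₁.rot_div_mem (by omega) ?_
      rw [himage₁]
      exact Subgroup.subset_closure (by simp)
    have h2 : rot (k * Real.pi / p₂) ∈ Γ₂ := by
      refine hΓ₂.rot_div_mem (by omega) ?_
      rw [himage₂]
      exact Subgroup.mem_zpowers _
    obtain ⟨s, t, hs, ht, hst⟩ := exists_rot_mul_rot (by omega) (by omega) h1 h2 n
    refine ⟨s, t, hs, ht, hst.trans ?_⟩
    rw [hθ]
    field_simp
  have hcorona_sub : edgeCorona (image Γ₁) 0 ⊆ MulAction.orbit Γ₁ (0 : 𝔻) \ {0} := by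
    intro x hx
    have h1 : x ∈ {x ∈ MulAction.orbit Γ₁ (0 : 𝔻) | ‖(x : ℂ)‖ < R} := by
      rw [hcorona]
      exact Or.inl hx
    exact ⟨h1.1, hx.2.1⟩
  have hcorona_mem : ∀ x ∈ MulAction.orbit Γ₁ (0 : 𝔻), x ≠ 0 → ‖(x : ℂ)‖ < R →
      x ∈ edgeCorona (image Γ₁) 0 := by
    intro x hx hx0 hxR
    have h1 : x ∈ edgeCorona (image Γ₁) 0 ∪ {0} := by
      rw [← hcorona]
      exact ⟨hx, hxR⟩
    exact h1.resolve_right hx0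
  unfold fundInterior domainInterior
  refine Set.Subset.antisymm
    (Set.sdiff_subset_sdiff_right (Set.biUnion_subset_biUnion_left hcorona_sub)) ?_
  rintro a ⟨ha, hnot⟩
  refine ⟨ha, ?_⟩
  simp only [Set.mem_iUnion, not_exists] at hnot ⊢
  intro x hx hax
  obtain ⟨hxorb, hx0⟩ := hx
  by_cases hxR : ‖(x : ℂ)‖ < R
  · exact hnot x (hcorona_mem x hxorb hx0 hxR) hax
  rw [not_lt] at hxR
  obtain ⟨⟨a', ha'⟩, hmem, rfl⟩ := ha
  have hmem' := interior_subset hmem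
  have haQ : a' ∈ prism Γ₁ Γ₂ 0 0 := (isClosed_prism _ _ _ _).frontier_subset hmem'.2
  have hre := re_w_of_mem_tangentSpace ha'
  have hfix : ∀ g ∈ Γ₂, g • (0 : 𝔻) = 0 := fun g hg => smul_zero_of_image_eq himage₂ hg
  -- the height `t` of the point, between `1` and `sec θ`
  have ht1 : 1 ≤ ‖a'.w‖ := hre ▸ Complex.re_le_norm a'.w
  have ht0 : ‖a'.w‖ ≤ sec θ := by
    have h1 := norm_le_sec_of_mem_prism hθ0 (by linarith) hrot Γ₁.one_mem
      (a := a') (by rwa [one_smul])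
    simpa using h1
  have htpos : 0 < ‖a'.w‖ := by linarith
  have hW : Real.cos (Real.pi / q) ^ 2 ≤ 1 / ‖a'.w‖ ^ 2 := by
    rw [← one_div_pow]
    refine pow_le_pow_left₀ hc.le (hcosθ.trans ?_) 2
    rw [le_div_iff₀ htpos]
    rw [sec, le_div_iff₀ (hc.trans_le hcosθ)] at ht0
    linarith
  have hy1 : ‖a'.z / a'.w‖ < 1 := by
    rw [norm_div, div_lt_one htpos]
    exact a'.norm_lt'
  have hylt : ‖a'.z / a'.w‖ < ellMinus (hypDist 0 v) q ‖a'.w‖ := by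
    by_contra! hge
    obtain ⟨j, n, hn, hcov⟩ := exists_rotation_covering hv (by omega : 0 < p₁) htpos hs hc.le hhalf
      hW hy1 hge
    set x' : 𝔻 := rotation 0 (j * (2 * Real.pi / p₁)) (rotation v (n * (2 * Real.pi / q)) 0)
      with hx'
    refine hnot x' (hcorona_mem x' ?_ ?_ ?_) (mem_prism hfix hcov)
    · have h1 : rotation 0 (j * (2 * Real.pi / p₁)) * rotation v (n * (2 * Real.pi / q)) ∈
          image Γ₁ := by
        rw [himage₁, ← rotation_zpow, ← rotation_zpow]
        exact mul_mem (zpow_mem (Subgroup.subset_closure (by simp)) _)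
          (zpow_mem (Subgroup.subset_closure (by simp)) _)
      exact mem_orbit_of_mem_image h1 0
    · intro h0
      have h1 : ((rotation v (n * (2 * Real.pi / q)) 0 : 𝔻) : ℂ) = 0 := by
        have h2 := congrArg Complex.UnitDisc.coe h0
        rw [hx', coe_rotation_zero, Complex.UnitDisc.coe_zero] at h2
        exact (mul_eq_zero.1 h2).resolve_left (Complex.exp_ne_zero _)
      rw [Complex.UnitDisc.coe_eq_zero, show (n : ℝ) * (2 * Real.pi / q) =
        2 * (n * (Real.pi / q)) by ring] at h1
      refine rotation_apply_zero_ne_zero hv ?_ h1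
      rcases hn with rfl | rfl <;> simpa using hs.ne'
    · refine lt_of_lt_of_le ?_ hR
      have h1 : ‖(x' : ℂ)‖ = ‖((rotation v (2 * (n * (Real.pi / q))) 0 : 𝔻) : ℂ)‖ := by
        rw [hx', coe_rotation_zero, norm_mul, Complex.norm_exp_ofReal_mul_I, one_mul]
        congr 4
        ring
      rw [h1]
      refine norm_rotation_lt_tanh hv ?_
      rcases hn with rfl | rfl <;> simpa using hc.ne'
  obtain ⟨⟨g, hg⟩, hgx⟩ := hxorb
  have hgx' : g • (0 : 𝔻) = x := hgx
  subst hgx'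
  have hle := norm_le_sec_of_mem_prism hθ0 (by linarith) hrot hg hax
  have heq := norm_inv_mul_w g.2 a'
  have hfar := lt_mul_one_sub_of_lt_ellMinus hL hs htpos ht0 hR hell hylt hxR
    (Complex.UnitDisc.norm_lt_one _) (norm_nonneg _)
  have hge : 1 - ‖((g • (0 : 𝔻) : 𝔻) : ℂ)‖ * ‖a'.z / a'.w‖ ≤
      ‖1 - conj ((g • (0 : 𝔻) : 𝔻) : ℂ) * (a'.z / a'.w)‖ := by
    have h1 := norm_sub_norm_le 1 (conj ((g • (0 : 𝔻) : 𝔻) : ℂ) * (a'.z / a'.w))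
    rwa [norm_one, norm_mul, Complex.norm_conj] at h1
  have h1 := mul_le_mul_of_nonneg_left hge htpos.le
  have h2 := mul_le_mul_of_nonneg_right hle
    (Real.sqrt_nonneg (1 - ‖((g • (0 : 𝔻) : 𝔻) : ℂ)‖ ^ 2))
  rw [show ‖((g : Cover)⁻¹ * a').w‖ * √(1 - ‖((g • (0 : 𝔻) : 𝔻) : ℂ)‖ ^ 2) = _ from heq] at h2
  exact absurd (hfar.trans_le (h1.trans h2)) (lt_irrefl _)
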